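/- Let $r\ge 2$ and $n,k_1,\dots,k_r$ be positive integers with $k_1\ge k_2\ge\dots\ge k_r$ and $n\ge k_1+k_2$. Write $[n]=\{1,\dots,n\}$ and let $\binom{[n]}{k}$ be the family of all $k$-subsets of $[n]$. Let $\mathcal F_i\subseteq\binom{[n]}{k_i}$, $i=1,\dots,r$, be non-empty families that are cross-intersecting, i.e. $A\cap B\ne\emptyset$ whenever $A\in\mathcal F_i$, $B\in\mathcal F_j$ and $1\le i<j\le r$. Put $$h=\binom{n}{k_1}-\binom{n-k_r}{k_1}+\sum_{i=2}^{r}\binom{n-k_r}{k_i-k_r},\qquad s=\sum_{i=1}^{r}\binom{n-1}{k_i-1}.$$ Then $$\sum_{i=1}^{r}|\mathcal F_i|\le\max\{h,s\},$$ and equality holds if and only if one of the following holds. (1) $n=k_1+k_r$ and one of the following holds: (i) $r=2$, $\mathcal F_1=\binom{[n]}{k_1}\setminus\{[n]\setminus F: F\in\mathcal F_2\}$ and $0<|\mathcal F_2|<\binom{n}{k_2}$; (ii) $r>2$, $k_1>k_2=\dots=k_r$, and there exists $x\in[n]$ such that $\mathcal F_i=\{F\in\binom{[n]}{k_i}:x\in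 F\}$ for every $i\in[r]$; (iii) $r>2$, $k_1=k_2=\dots=k_r$, and there is a family $\mathcal F\subseteq\binom{[n]}{k_1}$, any two members of which intersect, with $|\mathcal F|=\binom{n-1}{k_1-1}$ and $\mathcal F_i=\mathcal F$ for every $i\in[r]$. (2) $n>k_1+k_r$ and one of the following holds: (i) $s\ge h$, and there exists $x\in[n]$ such that $\mathcal F_i=\{F\in\binom{[n]}{k_i}:x\in F\}$ for every $i\in[r]$; (ii) $h\ge s$, and there exist $S\in\binom{[n]}{k_r}$ and $j\in[r]$ with $k_j=k_1$ such that $\mathcal F_j=\{F\in\binom{[n]}{k_j}:F\cap S\ne\emptyset\}$ and $\mathcal F_i=\{F\in\binom{[n]}{k_i}:S\subseteq F\}$ for every $i\in[r]\setminus\{j\}$. -/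

import Mathlib

open Finset

/-- The family of all `k`-subsets of an `n`-element ground set. -/
def layer (n k : ℕ) : Finset (Finset (Fin n)) :=
  powersetCard k univ

/-- The `k`-sets containing the point `x`. -/
def starFamily (n k : ℕ) (x : Fin n) : Finset (Finset (Fin n)) :=
  {A ∈ layer n k | x ∈ A}

/-- The `k`-sets containing the set `S`. -/
def containingFamily (n k : ℕ) (S : Finset (Fin n)) : Finset (Finset (Fin n)) :=
  {A ∈ layer n k | S ⊆ A}

/-- The `k`-sets meeting the set `S`. -/
def hittingFamily (n k : ℕ) (S : Finset (Fin n)) : Finset (Finset (Fin n)) :=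
  {A ∈ layer n k | (A ∩ S).Nonempty}

/-- The family of complements of the members of `G`. -/
def complementFamily {n : ℕ} (G : Finset (Finset (Fin n))) : Finset (Finset (Fin n)) :=
  G.image (fun A => univ \ A)

/-- Any two members of the family (possibly equal) meet. -/
def IntersectingFamily {n : ℕ} (G : Finset (Finset (Fin n))) : Prop :=
  ∀ A ∈ G, ∀ B ∈ G, 1 ≤ #(A ∩ B)

/-- The families `F 1, …, F r` are cross-intersecting. Values of `F` at other indices play
no role. -/
def CrossIntersecting {n : ℕ} (r : ℕ) (F : ℕ → Finset (Finset (Fin n))) : Prop :=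
  ∀ i ∈ Icc 1 r, ∀ j ∈ Icc 1 r, i < j → ∀ A ∈ F i, ∀ B ∈ F j, 1 ≤ #(A ∩ B)

/-- The total size `C(n,k₁) - C(n-k_r,k₁) + ∑_{i=2}^r C(n-k_r,k_i-k_r)` of the configuration
formed by one hitting family and `r - 1` containing families of a `k_r`-set. -/
def hittingBound (n r : ℕ) (k : ℕ → ℕ) : ℕ :=
  n.choose (k 1) - (n - k r).choose (k 1) + ∑ i ∈ Icc 2 r, (n - k r).choose (k i - k r)

/-- The total size `∑_{i=1}^r C(n-1,k_i-1)` of `r` stars. -/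
def starBound (n r : ℕ) (k : ℕ → ℕ) : ℕ :=
  ∑ i ∈ Icc 1 r, (n - 1).choose (k i - 1)

/-! Write n = m + 1 and call `F j` large if it has more members than a star, i.e. more than C(m, k_j
- 1). If no family is large, the total is at most s termwise. Equality then gives every family the
size of a star, and two cross-intersecting families of these sizes with k_p + k_q < n are stars with
a common centre (`eq_star_of_card_eq`). This rests on an inductive Lovász form of Kruskal–Katona
with its case of equality (`card_cliqueFamily_le`).

If `F j` is large, Kruskal–Katona for complements (`exists_link_family`) compares it with a full
star plus a non-empty family G of k_j-sets on m points, and every other `F i` falls short of a star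
by at least the number of (k_i - 1)-sets disjoint from some member of G. So the total is at most s +
`gain` G, where the gain is |G| minus the sizes of these neighbourhoods. Negative gain means a total
below s. Otherwise, if k_j is the largest size and k_j + k_i < n for all other i, `gain_le_hitting`
applies. The gain is supermodular, so a smallest family of maximum gain is invariant under
transpositions carrying a set that it hits to another such set; with compressions this forces it to
be all k_j-sets meeting a fixed (k_r - 1)-set, whose gain is h - s. In the remaining cases another
layer is larger than, or complementary to, that of G, and double counting in the disjointness graph
keeps the total below s (`sum_lt_of_big_of_large_layer`).

On the boundary n = k_1 + k_r all sizes from k_2 on agree. For r = 2 one pairs sets with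
complements; for r > 2 and k_1 = k_2 one counts in how many families a set and its complement lie
(`sum_le_of_half`); for k_1 > k_2 the general argument works. -/

/-! ### Clique form of the Kruskal–Katona theorem. -/

section Clique

variable {α : Type*} [DecidableEq α]

/-- The sets `A` avoiding `v` with `insert v A ∈ G`. -/
def linkFamily (v : α) (G : Finset (Finset α)) : Finset (Finset α) :=
  {A ∈ G | v ∈ A}.image (fun A => A.erase v)

theorem erase_injOn_family (v : α) (G : Finset (Finset α)) :
    Set.InjOn (fun A : Finset α => A.erase v) ({A ∈ G | v ∈ A} : Finset (Finset α)) := by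
  intro A hA B hB h
  simp only [coe_filter, Set.mem_ofPred_eq] at hA hB
  have := congrArg (insert v) h
  simpa [insert_erase hA.2, insert_erase hB.2] using this

theorem card_linkFamily (v : α) (G : Finset (Finset α)) :
    #(linkFamily v G) = #{A ∈ G | v ∈ A} :=
  card_image_of_injOn (erase_injOn_family v G)

variable [Fintype α]

/-- The `k`-sets all of whose `(k-1)`-subsets belong to `G`. -/
def cliqueFamily (k : ℕ) (G : Finset (Finset α)) : Finset (Finset α) :=
  {X ∈ powersetCard k univ | ∀ x ∈ X, X.erase x ∈ G}

theorem mem_cliqueFamily {k : ℕ} {G : Finset (Finset α)} {X : Finset α} :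
    X ∈ cliqueFamily k G ↔ #X = k ∧ ∀ x ∈ X, X.erase x ∈ G := by
  simp [cliqueFamily]

theorem sum_card_filter_mem {k : ℕ} {G : Finset (Finset α)} (hG : ∀ A ∈ G, #A = k) :
    ∑ v, #{A ∈ G | v ∈ A} = k * #G := by
  have h := sum_card_bipartiteAbove_eq_sum_card_bipartiteBelow
    (s := (univ : Finset α)) (t := G) (fun v A => v ∈ A)
  have h' : ∀ A ∈ G, #(bipartiteBelow (fun v A => v ∈ A) (univ : Finset α) A) = k := by
    intro A hA
    rw [← hG A hA]
    congr 1
    ext v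
    simp [bipartiteBelow]
  rw [sum_congr rfl h'] at h
  simpa [bipartiteAbove, mul_comm] using h

/-- Erasing `v` sends the cliques through `v` injectively to members of `G` avoiding `v`. -/
theorem card_clique_mem_add_le (k : ℕ) (v : α) (G : Finset (Finset α)) :
    #{X ∈ cliqueFamily k G | v ∈ X} + #{A ∈ G | v ∈ A} ≤ #G := by
  have h1 : #{X ∈ cliqueFamily k G | v ∈ X} ≤ #{A ∈ G | v ∉ A} := by
    rw [← card_linkFamily]
    apply card_le_card
    intro A hA
    obtain ⟨X, hX, rfl⟩ := mem_image.1 hA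
    rw [mem_filter, mem_cliqueFamily] at hX
    exact mem_filter.2 ⟨hX.1.2 v hX.2, notMem_erase v X⟩
  have h2 := card_filter_add_card_filter_not (s := G) (fun A => v ∈ A)
  omega

/-- A clique through `v` loses `v` and becomes a clique of the link; this drives the induction on
`k`. -/
theorem card_clique_mem_le_link (k : ℕ) (v : α) (G : Finset (Finset α)) :
    #{X ∈ cliqueFamily (k + 1) G | v ∈ X} ≤ #(cliqueFamily k (linkFamily v G)) := by
  rw [← card_linkFamily]
  apply card_le_card
  intro A hA
  obtain ⟨X, hX, rfl⟩ := mem_image.1 hA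
  rw [mem_filter, mem_cliqueFamily] at hX
  rw [mem_cliqueFamily]
  refine ⟨by rw [card_erase_of_mem hX.2, hX.1.1]; rfl, fun y hy => ?_⟩
  rw [mem_erase] at hy
  refine mem_image.2 ⟨X.erase y, mem_filter.2 ⟨hX.1.2 y hy.2, mem_erase.2 ⟨hy.1.symm, hX.2⟩⟩, ?_⟩
  exact erase_right_comm

theorem linkFamily_subset {k : ℕ} (v : α) {G : Finset (Finset α)}
    (hG : G ⊆ powersetCard (k + 1) univ) : linkFamily v G ⊆ powersetCard k univ := by
  intro A hA
  obtain ⟨B, hB, rfl⟩ := mem_image.1 hA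
  rw [mem_filter] at hB
  have := (mem_powersetCard.1 (hG hB.1)).2
  exact mem_powersetCard.2 ⟨subset_univ _, by rw [card_erase_of_mem hB.2, this]; rfl⟩

/-- The inequality is proved at each vertex and summed. At a vertex of degree at least C(m, k) it
follows from `card_clique_mem_add_le` and (k+1) C(m+1, k+1) = (m+1) C(m, k); vertices of smaller
positive degree are left to `hlink`, which the induction supplies in strict form. -/
theorem card_cliqueFamily_le_of_link (k m : ℕ) (G : Finset (Finset α))
    (hG : G ⊆ powersetCard (k + 1) univ) (hm : #G ≤ (m + 1).choose (k + 1))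
    (hlink : ∀ v, 0 < #{A ∈ G | v ∈ A} → #{A ∈ G | v ∈ A} < m.choose k →
      (k + 1) * #{X ∈ cliqueFamily (k + 2) G | v ∈ X} + (k + 1) * #{A ∈ G | v ∈ A} <
        (m + 1) * #{A ∈ G | v ∈ A}) :
    (k + 2) * #(cliqueFamily (k + 2) G) + (k + 1) * #G ≤ (m + 1) * #G ∧
    ((k + 2) * #(cliqueFamily (k + 2) G) + (k + 1) * #G = (m + 1) * #G →
      G = ∅ ∨ ∃ T : Finset α, #T = m + 1 ∧ G = powersetCard (k + 1) T) := by
  have hcard : ∀ A ∈ G, #A = k + 1 := fun A hA => (mem_powersetCard.1 (hG hA)).2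
  have hchoose := Nat.add_one_mul_choose_eq m k
  have hv : ∀ v, (k + 1) * #{X ∈ cliqueFamily (k + 2) G | v ∈ X} + (k + 1) * #{A ∈ G | v ∈ A} ≤
      (m + 1) * #{A ∈ G | v ∈ A} ∧
      ((k + 1) * #{X ∈ cliqueFamily (k + 2) G | v ∈ X} + (k + 1) * #{A ∈ G | v ∈ A} =
      (m + 1) * #{A ∈ G | v ∈ A} → #{A ∈ G | v ∈ A} = 0 ∨
        (#G = (m + 1).choose (k + 1) ∧ #{A ∈ G | v ∈ A} = m.choose k)) := by
    intro v
    have h1 := card_clique_mem_add_le (k + 2) v G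
    rcases Nat.eq_zero_or_pos #{A ∈ G | v ∈ A} with h0 | h0
    · have h2 : #{X ∈ cliqueFamily (k + 2) G | v ∈ X} = 0 := by
        rw [card_eq_zero, filter_eq_empty_iff]
        intro X hX hvX
        rw [mem_cliqueFamily] at hX
        obtain ⟨y, hy, hyv⟩ : ∃ y ∈ X, y ≠ v :=
          exists_mem_ne (by omega) v
        have : X.erase y ∈ ({A ∈ G | v ∈ A} : Finset (Finset α)) :=
          mem_filter.2 ⟨hX.2 y hy, mem_erase.2 ⟨hyv.symm, hvX⟩⟩
        rw [card_eq_zero] at h0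
        simp [h0] at this
      rw [h0, h2]
      simp
    rcases lt_or_ge #{A ∈ G | v ∈ A} (m.choose k) with h2 | h2
    · have := hlink v h0 h2
      exact ⟨this.le, fun h => absurd h this.ne⟩
    · have h3 : (k + 1) * (#{X ∈ cliqueFamily (k + 2) G | v ∈ X} + #{A ∈ G | v ∈ A}) ≤
          (k + 1) * #G := Nat.mul_le_mul_left _ h1
      have h4 : (k + 1) * #G ≤ (k + 1) * (m + 1).choose (k + 1) := Nat.mul_le_mul_left _ hm
      have h5 : (m + 1) * m.choose k ≤ (m + 1) * #{A ∈ G | v ∈ A} := Nat.mul_le_mul_left _ h2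
      rw [mul_add] at h3
      rw [mul_comm ((m + 1).choose (k + 1))] at hchoose
      refine ⟨by omega, fun h => Or.inr ⟨?_, ?_⟩⟩
      · exact Nat.eq_of_mul_eq_mul_left (show 0 < k + 1 by omega) (by omega)
      · exact Nat.eq_of_mul_eq_mul_left (show 0 < m + 1 by omega) (by omega)
  have hs1 := sum_card_filter_mem (k := k + 2) (G := cliqueFamily (k + 2) G)
    (fun X hX => (mem_cliqueFamily.1 hX).1)
  have hs2 := sum_card_filter_mem hcard
  have hle := sum_le_sum (fun v (_ : v ∈ (univ : Finset α)) => (hv v).1)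
  rw [sum_add_distrib, ← mul_sum, ← mul_sum, ← mul_sum, hs1, hs2] at hle
  constructor
  · refine Nat.le_of_mul_le_mul_left (c := k + 1) ?_ (Nat.succ_pos k)
    linarith
  intro heq
  rcases G.eq_empty_or_nonempty with rfl | ⟨A₀, hA₀⟩
  · exact Or.inl rfl
  right
  have hall : ∀ v ∈ (univ : Finset α), (k + 1) * #{X ∈ cliqueFamily (k + 2) G | v ∈ X} +
      (k + 1) * #{A ∈ G | v ∈ A} = (m + 1) * #{A ∈ G | v ∈ A} := by
    rw [← sum_eq_sum_iff_of_le (fun v _ => (hv v).1), sum_add_distrib, ← mul_sum, ← mul_sum,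
      ← mul_sum, hs1, hs2]
    linarith [congrArg ((k + 1) * ·) heq]
  have hd : ∀ v A, A ∈ G → v ∈ A → #G = (m + 1).choose (k + 1) ∧ #{A ∈ G | v ∈ A} = m.choose k := by
    intro v A hA hvA
    refine ((hv v).2 (hall v (mem_univ v))).resolve_left ?_
    exact (card_pos.2 ⟨A, mem_filter.2 ⟨hA, hvA⟩⟩).ne'
  obtain ⟨v₀, hv₀⟩ : A₀.Nonempty := card_pos.1 (by rw [hcard A₀ hA₀]; omega)
  have hGc := (hd v₀ A₀ hA₀ hv₀).1
  have hc0 : 0 < m.choose k := by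
    rw [← (hd v₀ A₀ hA₀ hv₀).2]
    exact card_pos.2 ⟨A₀, mem_filter.2 ⟨hA₀, hv₀⟩⟩
  have hsub : G ⊆ powersetCard (k + 1) (G.biUnion id) := fun A hA =>
    mem_powersetCard.2 ⟨fun v hvA => mem_biUnion.2 ⟨A, hA, hvA⟩, hcard A hA⟩
  -- In the case of equality all positive degrees are C(m, k), so the degree sum determines the size
  -- of the support.
  have hT : #(G.biUnion id) = m + 1 := by
    have h1 : ∑ v ∈ G.biUnion id, #{A ∈ G | v ∈ A} = (k + 1) * #G := by
      rw [← hs2]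
      apply sum_subset (subset_univ _)
      intro v _ hvT
      rw [card_eq_zero, filter_eq_empty_iff]
      exact fun A hA hvA => hvT (mem_biUnion.2 ⟨A, hA, hvA⟩)
    rw [sum_congr rfl (g := fun _ => m.choose k)] at h1
    · rw [sum_const, smul_eq_mul, hGc, mul_comm (k + 1), ← hchoose] at h1
      exact Nat.eq_of_mul_eq_mul_right hc0 h1
    · intro v hvT
      obtain ⟨A, hA, hvA⟩ := mem_biUnion.1 hvT
      exact (hd v A hA hvA).2
  exact ⟨G.biUnion id, hT, eq_of_subset_of_card_le hsub (by rw [card_powersetCard, hT, hGc])⟩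

/-- The integral Lovász form of the Kruskal–Katona theorem in terms of cliques, with the case of
equality. -/
theorem card_cliqueFamily_le (k m : ℕ) (G : Finset (Finset α))
    (hG : G ⊆ powersetCard (k + 1) univ) (hm : #G ≤ (m + 1).choose (k + 1)) :
    (k + 2) * #(cliqueFamily (k + 2) G) + (k + 1) * #G ≤ (m + 1) * #G ∧
    ((k + 2) * #(cliqueFamily (k + 2) G) + (k + 1) * #G = (m + 1) * #G →
      G = ∅ ∨ ∃ T : Finset α, #T = m + 1 ∧ G = powersetCard (k + 1) T) := by
  induction k generalizing G m with
  | zero => exact card_cliqueFamily_le_of_link 0 m G hG hm (fun v h0 h1 => absurd h1 (by rw [Nat.choose_zero_right]; omega))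
  | succ k ih =>
    refine card_cliqueFamily_le_of_link (k + 1) m G hG hm (fun v h0 h1 => ?_)
    rcases m with _ | m
    · simp at h1
    have h2 := ih m (linkFamily v G) (linkFamily_subset v hG)
      (by rw [card_linkFamily]; exact h1.le)
    have h3 := card_clique_mem_le_link (k + 2) v G
    rw [← card_linkFamily v G] at h0 h1 ⊢
    have h4 : (k + 2) * #(cliqueFamily (k + 2) (linkFamily v G)) + (k + 1) * #(linkFamily v G) ≠
        (m + 1) * #(linkFamily v G) := by
      intro h
      rcases h2.2 h with h | ⟨T, hT, h⟩
      · simp [h] at h0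
      · rw [h, card_powersetCard, hT] at h1
        exact lt_irrefl _ h1
    have h5 := lt_of_le_of_ne h2.1 h4
    have h6 := Nat.mul_le_mul_left (k + 2) h3
    linarith

end Clique

/-! ### Neighbourhoods in the disjointness graph and uniqueness of stars. -/

section StarUniqueness

variable {α : Type*} [Fintype α] [DecidableEq α]

/-- The `b`-sets disjoint from some member of `G`. -/
def nbr (b : ℕ) (G : Finset (Finset α)) : Finset (Finset α) :=
  {B ∈ powersetCard b univ | ∃ A ∈ G, Disjoint A B}

theorem mem_nbr {b : ℕ} {G : Finset (Finset α)} {B : Finset α} :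
    B ∈ nbr b G ↔ #B = b ∧ ∃ A ∈ G, Disjoint A B := by
  simp [nbr]

theorem nbr_subset (b : ℕ) (G : Finset (Finset α)) : nbr b G ⊆ powersetCard b univ :=
  filter_subset _ _

theorem nbr_succ_subset_clique (t : ℕ) (G : Finset (Finset α)) :
    nbr (t + 1) G ⊆ cliqueFamily (t + 1) (nbr t G) := by
  intro X hX
  obtain ⟨hX, A, hA, hAX⟩ := mem_nbr.1 hX
  refine mem_cliqueFamily.2 ⟨hX, fun x hx => mem_nbr.2 ⟨?_, A, hA, ?_⟩⟩
  · rw [card_erase_of_mem hx, hX]; rfl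
  · exact hAX.mono_right (erase_subset x X)

/-- In the top layer the only set disjoint from a given member is its complement. -/
theorem card_nbr_compl {l : ℕ} {B : Finset (Finset α)} (hB : B ⊆ powersetCard l univ) :
    #(nbr (Fintype.card α - l) B) = #B := by
  have hl : ∀ X ∈ B, #X = l := fun X hX => (mem_powersetCard.1 (hB hX)).2
  have h : nbr (Fintype.card α - l) B = B.image compl := by
    ext Y
    rw [mem_nbr, mem_image]
    constructor
    · rintro ⟨hY, A, hA, hAY⟩
      refine ⟨A, hA, (eq_of_subset_of_card_le ?_ ?_).symm⟩
      · rw [subset_compl_iff_disjoint_left]; exact hAY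
      · rw [card_compl, hl A hA, hY]
    · rintro ⟨A, hA, rfl⟩
      exact ⟨by rw [card_compl, hl A hA], A, hA, disjoint_compl_right⟩
  rw [h, card_image_of_injective _ compl_injective]

theorem card_nbr_add_le {k : ℕ} {A B : Finset (Finset α)} (hA : A ⊆ powersetCard k univ)
    (hcross : ∀ X ∈ A, ∀ Y ∈ B, ¬ Disjoint X Y) :
    #A + #(nbr k B) ≤ (Fintype.card α).choose k := by
  rw [← card_univ, ← card_powersetCard, ← card_union_of_disjoint]
  · exact card_le_card (union_subset hA (nbr_subset k B))
  · rw [disjoint_left]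
    intro X hX hX'
    obtain ⟨-, Y, hY, hYX⟩ := mem_nbr.1 hX'
    exact hcross X hX Y hY hYX.symm

/-- Going up one layer, the clique bound multiplies the neighbourhood by at most the ratio of
consecutive binomials C(m+1, ·), so a strict deficit persists. -/
theorem card_nbr_lt_choose {m t : ℕ} (ht : 1 ≤ t) {B : Finset (Finset α)}
    (h : #(nbr t B) < (m + 1).choose t) (d : ℕ) (hd : t + d ≤ m + 1) :
    #(nbr (t + d) B) < (m + 1).choose (t + d) := by
  induction d with
  | zero => exact h
  | succ d ih =>
    have ih := ih (by omega)
    obtain ⟨k, hk⟩ : ∃ k, t + d = k + 1 := ⟨t + d - 1, by omega⟩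
    rw [← add_assoc, hk] at hd ⊢
    rw [hk] at ih
    have h1 := (card_cliqueFamily_le k m _ (nbr_subset (k + 1) B) ih.le).1
    have h2 := Nat.mul_le_mul_left (k + 2) (card_le_card (nbr_succ_subset_clique (k + 1) B))
    have h3 := Nat.choose_succ_right_eq (m + 1) (k + 1)
    obtain ⟨e, he⟩ : ∃ e, m + 1 = k + 1 + (e + 1) := ⟨m - k - 1, by omega⟩
    have h4 : m + 1 - (k + 1) = e + 1 := by omega
    rw [h4] at h3
    have h5 : (e + 1) * #(nbr (k + 1) B) < (e + 1) * (m + 1).choose (k + 1) :=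
      Nat.mul_lt_mul_of_pos_left ih (by omega : 0 < e + 1)
    have h6 : (m + 1) * #(nbr (k + 1) B) =
      (k + 1) * #(nbr (k + 1) B) + (e + 1) * #(nbr (k + 1) B) := by rw [he]; ring
    refine Nat.lt_of_mul_lt_mul_left (a := k + 2) ?_
    have h7 : k + 1 + 1 = k + 2 := rfl
    rw [h7] at h2 h3 ⊢
    linarith

/-- Cross-intersecting families having the sizes of two stars are stars with a common centre. -/
theorem eq_star_of_card_eq {k l m : ℕ} (hk : 1 ≤ k) (hl : 1 ≤ l) (hkl : k + l ≤ m)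
    (hα : Fintype.card α = m + 1) {A B : Finset (Finset α)}
    (hA : A ⊆ powersetCard k univ) (hB : B ⊆ powersetCard l univ)
    (hcross : ∀ X ∈ A, ∀ Y ∈ B, ¬ Disjoint X Y)
    (hcA : #A = m.choose (k - 1)) (hcB : #B = m.choose (l - 1)) :
    ∃ x : α, A = {X ∈ powersetCard k (univ : Finset α) | x ∈ X} := by
  obtain ⟨k, rfl⟩ : ∃ k', k = k' + 1 := ⟨k - 1, by omega⟩
  obtain ⟨m, rfl⟩ : ∃ m', m = m' + 1 := ⟨m - 1, by omega⟩
  rw [Nat.add_sub_cancel] at hcA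
  have h1 := card_nbr_add_le hA hcross
  rw [hα, hcA, Nat.choose_succ_succ, add_le_add_iff_left] at h1
  -- A deficit here would climb to the layer of complements of members of `B`, where the
  -- neighbourhood has exactly #B members and there is none.
  have h2 : #(nbr (k + 1) B) = (m + 1).choose (k + 1) := by
    by_contra hne
    have h3 := card_nbr_lt_choose (by omega) (lt_of_le_of_ne h1 hne) (m + 1 + 1 - l - (k + 1))
      (by omega)
    have h4 := card_nbr_compl hB
    have h5 : k + 1 + (m + 1 + 1 - l - (k + 1)) = m + 1 + 1 - l := by omega
    rw [h5, ← hα, h4, hα,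
      hcB, Nat.choose_symm_of_eq_add (show m + 1 = l - 1 + (m + 1 + 1 - l) by omega)] at h3
    exact lt_irrefl _ h3
  have h3 := (card_cliqueFamily_le k m _ (nbr_subset (k + 1) B) h1)
  -- The same climb starting one layer higher, which `hkl` leaves room for. Equality in the clique
  -- bound then makes the neighbourhood a complete layer on all points but one, the centre.
  have h4 : (k + 2) * #(cliqueFamily (k + 2) (nbr (k + 1) B)) + (k + 1) * #(nbr (k + 1) B) =
      (m + 1) * #(nbr (k + 1) B) := by
    by_contra hne
    have h5 := lt_of_le_of_ne h3.1 hne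
    have h6 := Nat.mul_le_mul_left (k + 2) (card_le_card (nbr_succ_subset_clique (k + 1) B))
    have h7 : #(nbr (k + 2) B) < (m + 1).choose (k + 2) := by
      have h8 := Nat.choose_succ_right_eq (m + 1) (k + 1)
      obtain ⟨e, he⟩ : ∃ e, m + 1 = k + 1 + (e + 1) := ⟨m - k - 1, by omega⟩
      have h9 : m + 1 - (k + 1) = e + 1 := by omega
      rw [h9] at h8
      rw [h2] at h5
      have h10 : (m + 1) * (m + 1).choose (k + 1) =
        (k + 1) * (m + 1).choose (k + 1) + (e + 1) * (m + 1).choose (k + 1) := by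
        nth_rw 1 [he]; ring
      refine Nat.lt_of_mul_lt_mul_left (a := k + 2) ?_
      have h11 : k + 1 + 1 = k + 2 := rfl
      rw [h11] at h6 h8
      linarith
    have h8 := card_nbr_lt_choose (by omega) h7 (m + 1 + 1 - l - (k + 2)) (by omega)
    have h9 := card_nbr_compl hB
    have h10 : k + 2 + (m + 1 + 1 - l - (k + 2)) = m + 1 + 1 - l := by omega
    rw [h10, ← hα, h9, hα,
      hcB, Nat.choose_symm_of_eq_add (show m + 1 = l - 1 + (m + 1 + 1 - l) by omega)] at h8
    exact lt_irrefl _ h8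
  have hpos : 0 < (m + 1).choose (k + 1) := Nat.choose_pos (by omega)
  rcases h3.2 h4 with h5 | ⟨T, hT, h5⟩
  · rw [← h2, h5] at hpos
    simp at hpos
  obtain ⟨x, hx⟩ : ∃ x, Tᶜ = {x} := by
    rw [← card_eq_one, card_compl, hα, hT]; omega
  refine ⟨x, eq_of_subset_of_card_le ?_ ?_⟩
  · intro X hX
    refine mem_filter.2 ⟨hA hX, ?_⟩
    by_contra hxX
    have hXT : X ⊆ T := by
      intro y hy
      by_contra hyT
      rw [← mem_compl, hx, mem_singleton] at hyT
      exact hxX (hyT ▸ hy)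
    have hX' : X ∈ nbr (k + 1) B := by
      rw [h5]
      exact mem_powersetCard.2 ⟨hXT, (mem_powersetCard.1 (hA hX)).2⟩
    obtain ⟨-, Y, hY, hYX⟩ := mem_nbr.1 hX'
    exact hcross X hX Y hY hYX.symm
  · rw [hcA, ← card_linkFamily]
    have : #(powersetCard k T) = (m + 1).choose k := by rw [card_powersetCard, hT]
    rw [← this]
    apply card_le_card
    intro X hX
    obtain ⟨Y, hY, rfl⟩ := mem_image.1 hX
    rw [mem_filter, mem_powersetCard] at hY
    refine mem_powersetCard.2 ⟨?_, ?_⟩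
    · intro y hy
      by_contra hyT
      rw [← mem_compl, hx, mem_singleton] at hyT
      exact (mem_erase.1 hy).1 hyT
    · rw [card_erase_of_mem hY.2, hY.1.2]; rfl

end StarUniqueness

/-! ### Transpositions and compressions. -/

section Swap

variable {α : Type*} [DecidableEq α]

/-- Exchange induction: a property stable under replacing an element outside `C` by an element of
`C` passes from any set of the same size to `C`. -/
theorem exchange_induction (C : Finset α) (I : Finset α → Prop)
    (h : ∀ A, I A → ∀ y ∈ A, y ∉ C → ∀ x ∈ C, x ∉ A → I (insert x (A.erase y)))
    (A : Finset α) (hA : I A) (hAC : #A = #C) : I C := by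
  induction hd : #(C \ A) generalizing A with
  | zero =>
    rw [card_eq_zero, sdiff_eq_empty_iff_subset] at hd
    rwa [eq_of_subset_of_card_le hd hAC.le]
  | succ d ih =>
    obtain ⟨x, hx⟩ : (C \ A).Nonempty := card_pos.1 (by omega)
    obtain ⟨y, hy⟩ : (A \ C).Nonempty := by
      rw [← card_pos, card_sdiff_comm hAC]; omega
    rw [mem_sdiff] at hx hy
    refine ih _ (h A hA y hy.1 hy.2 x hx.1 hx.2) ?_ ?_
    · rw [card_insert_of_notMem (by simp [hx.2]), card_erase_of_mem hy.1, ← hAC]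
      have := card_pos.2 ⟨y, hy.1⟩
      omega
    · have : C \ insert x (A.erase y) = (C \ A).erase x := by
        ext z
        simp only [mem_sdiff, mem_insert, mem_erase]
        constructor
        · rintro ⟨hz, hz'⟩
          refine ⟨fun e => hz' (Or.inl e), hz, fun hzA => hz' (Or.inr ⟨?_, hzA⟩)⟩
          rintro rfl
          exact hy.2 hz
        · rintro ⟨hzx, hz, hzA⟩
          exact ⟨hz, fun h => h.elim hzx fun h => hzA h.2⟩
      rw [this, card_erase_of_mem (mem_sdiff.2 hx), hd]; rfl

/-- The image of a set under the transposition of `x` and `y`. -/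
def swapSet (x y : α) (A : Finset α) : Finset α := A.map (Equiv.swap x y).toEmbedding

theorem mem_swapSet {x y z : α} {A : Finset α} : z ∈ swapSet x y A ↔ Equiv.swap x y z ∈ A := by
  rw [swapSet, mem_map_equiv, Equiv.symm_swap]

@[simp]
theorem swapSet_swapSet (x y : α) (A : Finset α) : swapSet x y (swapSet x y A) = A := by
  ext z
  simp [mem_swapSet]

@[simp]
theorem card_swapSet (x y : α) (A : Finset α) : #(swapSet x y A) = #A := card_map _

theorem disjoint_swapSet {x y : α} {A B : Finset α} :
    Disjoint (swapSet x y A) B ↔ Disjoint A (swapSet x y B) := by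
  simp only [disjoint_left, mem_swapSet]
  constructor
  · intro h z hz hz'
    exact h (by simpa using hz) hz'
  · intro h z hz hz'
    exact h hz (by simpa using hz')

theorem swapSet_eq_self {x y : α} {A : Finset α} (h : x ∈ A ↔ y ∈ A) : swapSet x y A = A := by
  ext z
  rw [mem_swapSet]
  rcases eq_or_ne z x with rfl | hzx
  · simp [h]
  rcases eq_or_ne z y with rfl | hzy
  · simp [h]
  rw [Equiv.swap_apply_of_ne_of_ne hzx hzy]

theorem swapSet_eq_insert {x y : α} {A : Finset α} (hx : x ∉ A) (hy : y ∈ A) :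
    swapSet x y A = insert x (A.erase y) := by
  have hxy : x ≠ y := fun h => hx (h ▸ hy)
  ext z
  rw [mem_swapSet]
  rcases eq_or_ne z x with rfl | hzx
  · simp [hy]
  rcases eq_or_ne z y with rfl | hzy
  · simp [hx, hxy.symm]
  rw [Equiv.swap_apply_of_ne_of_ne hzx hzy]
  simp [hzx, hzy]

theorem swapSet_comm (x y : α) (A : Finset α) : swapSet x y A = swapSet y x A := by
  rw [swapSet, Equiv.swap_comm, swapSet]

theorem swapSet_injective (x y : α) : Function.Injective (swapSet x y) :=
  Function.LeftInverse.injective (swapSet_swapSet x y)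

theorem swapSet_conj {x y z : α} (hxy : x ≠ y) (hyz : y ≠ z) (hxz : x ≠ z) (A : Finset α) :
    swapSet x z A = swapSet x y (swapSet y z (swapSet x y A)) := by
  ext w
  simp only [mem_swapSet, Equiv.swap_apply_def]
  split_ifs <;> simp_all

/-- The image of a family under the transposition of `x` and `y`. -/
def swapFamily (x y : α) (G : Finset (Finset α)) : Finset (Finset α) := G.image (swapSet x y)

theorem mem_swapFamily {x y : α} {G : Finset (Finset α)} {A : Finset α} :
    A ∈ swapFamily x y G ↔ swapSet x y A ∈ G := by
  rw [swapFamily, mem_image]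
  constructor
  · rintro ⟨B, hB, rfl⟩
    simpa using hB
  · exact fun h => ⟨_, h, swapSet_swapSet x y A⟩

theorem card_swapFamily (x y : α) (G : Finset (Finset α)) : #(swapFamily x y G) = #G :=
  card_image_of_injective _ (swapSet_injective x y)

theorem swapFamily_trans {x y z : α} {G : Finset (Finset α)} (h1 : swapFamily x y G = G)
    (h2 : swapFamily y z G = G) : swapFamily x z G = G := by
  rcases eq_or_ne x y with rfl | hxy
  · exact h2
  rcases eq_or_ne y z with rfl | hyz
  · exact h1
  rcases eq_or_ne x z with rfl | hxz
  · ext A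
    rw [mem_swapFamily, swapSet_eq_self Iff.rfl]
  have e1 : ∀ A, swapSet x y A ∈ G ↔ A ∈ G := fun A => by rw [← mem_swapFamily, h1]
  have e2 : ∀ A, swapSet y z A ∈ G ↔ A ∈ G := fun A => by rw [← mem_swapFamily, h2]
  ext A
  rw [mem_swapFamily, swapSet_conj hxy hyz hxz, e1, e2, e1]

theorem swapFamily_comm (x y : α) (G : Finset (Finset α)) :
    swapFamily x y G = swapFamily y x G := by
  ext A
  rw [mem_swapFamily, mem_swapFamily, swapSet_comm]

theorem mem_compression_cases {x y : α} {G : Finset (Finset α)} {A : Finset α}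
    (hA : A ∈ UV.compression {x} {y} G) :
    (A ∈ G ∧ (x ∉ A → y ∈ A → swapSet x y A ∈ G)) ∨
      ∃ B ∈ G, x ∉ B ∧ y ∈ B ∧ A = swapSet x y B := by
  have hc : ∀ B : Finset α, x ∉ B → y ∈ B → UV.compress {x} {y} B = swapSet x y B := by
    intro B hx hy
    rw [UV.compress_of_disjoint_of_le (by simpa using hx) (by simpa using hy),
      swapSet_eq_insert hx hy]
    have hxy : x ≠ y := fun h => hx (h ▸ hy)
    ext z
    simp only [sup_eq_union, mem_sdiff, mem_union, mem_singleton, mem_insert, mem_erase]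
    constructor
    · rintro ⟨h | h, h'⟩
      · exact Or.inr ⟨h', h⟩
      · exact Or.inl h
    · rintro (rfl | ⟨h, h'⟩)
      · exact ⟨Or.inr rfl, hxy⟩
      · exact ⟨Or.inl h', h⟩
  rcases UV.mem_compression.1 hA with ⟨h1, h2⟩ | ⟨h1, B, hB, rfl⟩
  · exact Or.inl ⟨h1, fun hx hy => hc A hx hy ▸ h2⟩
  · right
    by_cases h : x ∉ B ∧ y ∈ B
    · exact ⟨B, hB, h.1, h.2, hc B h.1 h.2⟩
    · exfalso
      apply h1
      rwa [UV.compress, if_neg]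
      simpa using h

theorem mem_compression_of_mem_of_not {x y : α} {G : Finset (Finset α)} {A : Finset α}
    (hA : A ∈ G) (h : x ∈ A ∨ y ∉ A) : A ∈ UV.compression {x} {y} G := by
  have : UV.compress {x} {y} A = A := by
    rw [UV.compress, if_neg]
    rintro ⟨h1, h2⟩
    rcases h with h | h
    · simp [h] at h1
    · simp [h] at h2
  exact UV.mem_compression.2 (Or.inl ⟨hA, this.symm ▸ hA⟩)

/-- Two shifted sets share `x`. If a shifted set missed an unshifted `B`, transferring the
transposition to `B` would give a disjoint pair before compression: the swapped `B` still lies in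
its family, because the shift of `B` was blocked or `B` contains neither point. -/
theorem cross_compression {x y : α} {G H : Finset (Finset α)}
    (h : ∀ A ∈ G, ∀ B ∈ H, ¬ Disjoint A B) :
    ∀ A ∈ UV.compression {x} {y} G, ∀ B ∈ UV.compression {x} {y} H, ¬ Disjoint A B := by
  have key : ∀ {G H : Finset (Finset α)}, (∀ A ∈ G, ∀ B ∈ H, ¬ Disjoint A B) →
      ∀ A ∈ G, x ∉ A → y ∈ A → ∀ B ∈ H, (x ∉ B → y ∈ B → swapSet x y B ∈ H) →
      ¬ Disjoint (swapSet x y A) B := by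
    intro G H h A hA hxA hyA B hB hB' hd
    have hxB : x ∉ B := fun hxB => disjoint_left.1 hd (mem_swapSet.2 (by simpa using hyA)) hxB
    by_cases hyB : y ∈ B
    · exact h A hA _ (hB' hxB hyB) (disjoint_swapSet.1 hd)
    · rw [disjoint_swapSet, swapSet_eq_self (by simp [hxB, hyB])] at hd
      exact h A hA B hB hd
  intro A hA B hB
  rcases mem_compression_cases hA with ⟨hA, hA'⟩ | ⟨A', hA', hxA, hyA, rfl⟩ <;>
  rcases mem_compression_cases hB with ⟨hB, hB'⟩ | ⟨B', hB', hxB, hyB, rfl⟩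
  · exact h A hA B hB
  · intro hd
    exact key (fun B hB A hA hd => h A hA B hB hd.symm) B' hB' hxB hyB A hA hA' hd.symm
  · exact key h A' hA' hxA hyA B hB hB'
  · intro hd
    exact disjoint_left.1 hd (mem_swapSet.2 (by simpa using hyA) : x ∈ _)
      (mem_swapSet.2 (by simpa using hyB))

variable [Fintype α]

theorem nbr_swapFamily (b : ℕ) (x y : α) (G : Finset (Finset α)) :
    nbr b (swapFamily x y G) = swapFamily x y (nbr b G) := by
  ext B
  rw [mem_swapFamily, mem_nbr, mem_nbr, card_swapSet]
  refine and_congr_right fun _ => ?_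
  constructor
  · rintro ⟨A, hA, hAB⟩
    refine ⟨swapSet x y A, mem_swapFamily.1 hA, ?_⟩
    rwa [disjoint_swapSet, swapSet_swapSet]
  · rintro ⟨A, hA, hAB⟩
    refine ⟨swapSet x y A, mem_swapFamily.2 (by simpa using hA), ?_⟩
    rwa [disjoint_swapSet]

/-- The non-neighbours form the largest family of `b`-sets cross-intersecting with `G`. Compressing
both sides preserves cross-intersection and size, so non-neighbours cannot become fewer. -/
theorem card_nbr_compression_le (b : ℕ) (x y : α) (G : Finset (Finset α)) :
    #(nbr b (UV.compression {x} {y} G)) ≤ #(nbr b G) := by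
  set H := powersetCard b univ \ nbr b G with hH
  have h1 : ∀ A ∈ G, ∀ B ∈ H, ¬ Disjoint A B := by
    intro A hA B hB hd
    rw [hH, mem_sdiff, mem_powersetCard, mem_nbr] at hB
    exact hB.2 ⟨hB.1.2, A, hA, hd⟩
  have h2 : UV.compression {x} {y} H ⊆
      powersetCard b univ \ nbr b (UV.compression {x} {y} G) := by
    intro B hB
    have hc : #B = b := by
      have hs : ∀ C ∈ H, #C = b := fun C hC => by
        rw [hH, mem_sdiff, mem_powersetCard] at hC
        exact hC.1.2
      rcases mem_compression_cases hB with ⟨hB, -⟩ | ⟨C, hC, -, -, rfl⟩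
      · exact hs B hB
      · rw [card_swapSet, hs C hC]
    rw [mem_sdiff, mem_powersetCard, mem_nbr]
    refine ⟨⟨subset_univ _, hc⟩, ?_⟩
    rintro ⟨-, A, hA, hd⟩
    exact cross_compression h1 A hA B hB hd
  have h3 := card_le_card h2
  rw [UV.card_compression, hH, card_sdiff_of_subset (nbr_subset _ _),
    card_sdiff_of_subset (nbr_subset _ _)] at h3
  have h4 := card_le_card (nbr_subset b (UV.compression {x} {y} G))
  omega

end Swap

/-! ### Families of maximum gain. -/

section Gain

variable {α : Type*} [Fintype α] [DecidableEq α]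

/-- The size of `G` minus the total size of its neighbourhoods in the layers `b i`, `i ∈ ι`. -/
def gain (ι : Finset ℕ) (b : ℕ → ℕ) (G : Finset (Finset α)) : ℤ :=
  (#G : ℤ) - ∑ i ∈ ι, (#(nbr (b i) G) : ℤ)

/-- A non-empty family of `a`-sets all of whose members meet a common `c`-set. -/
def Admissible (a c : ℕ) (G : Finset (Finset α)) : Prop :=
  G ⊆ powersetCard a univ ∧ G.Nonempty ∧ ∃ B : Finset α, #B = c ∧ ∀ A ∈ G, ¬ Disjoint A B

/-- A smallest admissible family among those of maximum gain, the maximum being non-negative. -/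
def Optimal (ι : Finset ℕ) (b : ℕ → ℕ) (a c : ℕ) (G : Finset (Finset α)) : Prop :=
  Admissible a c G ∧ 0 ≤ gain ι b G ∧ ∀ G' : Finset (Finset α), Admissible a c G' →
    gain ι b G' ≤ gain ι b G ∧ (gain ι b G' = gain ι b G → #G ≤ #G')

theorem nbr_union (k : ℕ) (G G' : Finset (Finset α)) :
    nbr k (G ∪ G') = nbr k G ∪ nbr k G' := by
  ext B
  simp only [mem_nbr, mem_union]
  constructor
  · rintro ⟨h, A, hA | hA, hd⟩
    · exact Or.inl ⟨h, A, hA, hd⟩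
    · exact Or.inr ⟨h, A, hA, hd⟩
  · rintro (⟨h, A, hA, hd⟩ | ⟨h, A, hA, hd⟩)
    · exact ⟨h, A, Or.inl hA, hd⟩
    · exact ⟨h, A, Or.inr hA, hd⟩

/-- Supermodularity with its exact defect: by `nbr_inter_subset` every term of the last sum is
non-negative. -/
theorem gain_union_add_inter (ι : Finset ℕ) (b : ℕ → ℕ) (G G' : Finset (Finset α)) :
    gain ι b (G ∪ G') + gain ι b (G ∩ G') =
      gain ι b G + gain ι b G' +
        ∑ i ∈ ι, ((#(nbr (b i) G ∩ nbr (b i) G') : ℤ) - #(nbr (b i) (G ∩ G'))) := by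
  have h1 : (#(G ∪ G') : ℤ) + #(G ∩ G') = #G + #G' := mod_cast card_union_add_card_inter G G'
  have h2 : ∀ i ∈ ι, (#(nbr (b i) G) : ℤ) + #(nbr (b i) G') =
      #(nbr (b i) (G ∪ G')) + #(nbr (b i) G ∩ nbr (b i) G') := by
    intro i _
    rw [nbr_union]
    exact_mod_cast (card_union_add_card_inter _ _).symm
  have h3 := sum_congr rfl h2
  rw [sum_add_distrib, sum_add_distrib] at h3
  simp only [gain, sum_sub_distrib]
  linarith

theorem nbr_inter_subset (k : ℕ) (G G' : Finset (Finset α)) :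
    nbr k (G ∩ G') ⊆ nbr k G ∩ nbr k G' := by
  intro B hB
  obtain ⟨h, A, hA, hd⟩ := mem_nbr.1 hB
  rw [mem_inter] at hA
  exact mem_inter.2 ⟨mem_nbr.2 ⟨h, A, hA.1, hd⟩, mem_nbr.2 ⟨h, A, hA.2, hd⟩⟩

theorem gain_swapFamily (ι : Finset ℕ) (b : ℕ → ℕ) (x y : α) (G : Finset (Finset α)) :
    gain ι b (swapFamily x y G) = gain ι b G := by
  simp only [gain, nbr_swapFamily, card_swapFamily]

theorem swapFamily_subset_powersetCard {a : ℕ} {x y : α} {G : Finset (Finset α)}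
    (hG : G ⊆ powersetCard a univ) : swapFamily x y G ⊆ powersetCard a univ := by
  intro A hA
  have := (mem_powersetCard.1 (hG (mem_swapFamily.1 hA))).2
  exact mem_powersetCard.2 ⟨subset_univ _, by rwa [card_swapSet] at this⟩

variable {ι : Finset ℕ} {b : ℕ → ℕ} {a c : ℕ} {G : Finset (Finset α)}

/-- The union of `G` with its swapped copy still meets `B`, so its gain is not larger. By
supermodularity a non-empty intersection also has maximum gain, and minimality of `G` makes it all
of `G`. -/
theorem Optimal.swapFamily_eq (hG : Optimal ι b a c G) (hι : ι.Nonempty)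
    (hab : ∀ i ∈ ι, a + b i < Fintype.card α) {x y : α} {B : Finset α} (hBc : #B = c)
    (hB : ∀ A ∈ G, ¬ Disjoint A B) (hB' : ∀ A ∈ G, ¬ Disjoint A (swapSet x y B)) :
    swapFamily x y G = G := by
  obtain ⟨⟨hGa, hGn, -⟩, h0, hmax⟩ := hG
  have hsa := swapFamily_subset_powersetCard (x := x) (y := y) hGa
  have hU : Admissible a c (G ∪ swapFamily x y G) := by
    refine ⟨union_subset hGa hsa, hGn.mono subset_union_left, B, hBc, fun A hA => ?_⟩
    rcases mem_union.1 hA with hA | hA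
    · exact hB A hA
    · intro hd
      refine hB' _ (mem_swapFamily.1 hA) ?_
      rwa [disjoint_swapSet, swapSet_swapSet]
  have hsuper := gain_union_add_inter ι b G (swapFamily x y G)
  rw [gain_swapFamily] at hsuper
  have hterm : ∀ i ∈ ι, (0 : ℤ) ≤ (#(nbr (b i) G ∩ nbr (b i) (swapFamily x y G)) : ℤ) -
      #(nbr (b i) (G ∩ swapFamily x y G)) := fun i _ => by
    have := card_le_card (nbr_inter_subset (b i) G (swapFamily x y G))
    omega
  have hUle := (hmax _ hU).1
  rcases (G ∩ swapFamily x y G).eq_empty_or_nonempty with he | hne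
  -- With empty intersection the union has gain at least 2 gain(G) plus the number of common
  -- neighbours. Since gain(G) is non-negative, a single common neighbour contradicts maximality.
  · exfalso
    rw [he] at hsuper hterm
    have hgz : gain ι b (∅ : Finset (Finset α)) = 0 := by simp [gain, nbr]
    have hpos : 0 < ∑ i ∈ ι, ((#(nbr (b i) G ∩ nbr (b i) (swapFamily x y G)) : ℤ) -
        #(nbr (b i) (∅ : Finset (Finset α)))) := by
      obtain ⟨i, hi⟩ := hι
      refine sum_pos' hterm ⟨i, hi, ?_⟩
      obtain ⟨A, hA⟩ := hGn
      have hAc := (mem_powersetCard.1 (hGa hA)).2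
      -- A set and its swap cover at most `a + 1` points, which leaves room for a `b i`-set disjoint
      -- from both.
      have h1 : b i ≤ #(A ∪ swapSet x y A)ᶜ := by
        have h2 : #(A ∪ swapSet x y A) ≤ a + 1 := by
          have h3 : A ∪ swapSet x y A ⊆ A ∪ {x, y} ∧ (x ∈ A ∨ y ∈ A) := by
            constructor
            · intro z hz
              rcases mem_union.1 hz with hz | hz
              · exact mem_union_left _ hz
              · rw [mem_swapSet] at hz
                by_cases hzx : z = x
                · simp [hzx]
                by_cases hzy : z = y
                · simp [hzy]
                rw [Equiv.swap_apply_of_ne_of_ne hzx hzy] at hz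
                exact mem_union_left _ hz
            · by_contra hxy
              push Not at hxy
              have : A ∈ G ∩ swapFamily x y G := by
                rw [mem_inter, mem_swapFamily, swapSet_eq_self (by simp [hxy])]
                exact ⟨hA, hA⟩
              simp [he] at this
          rcases h3.2 with hx | hy
          · have : A ∪ {x, y} = insert y A := by aesop
            exact (card_le_card h3.1).trans (this ▸ (card_insert_le _ _).trans (by omega))
          · have : A ∪ {x, y} = insert x A := by aesop
            exact (card_le_card h3.1).trans (this ▸ (card_insert_le _ _).trans (by omega))
        have := hab i hi
        rw [card_compl]
        omega
      obtain ⟨X, hX, hXc⟩ := exists_subset_card_eq h1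
      rw [subset_compl_iff_disjoint_left, disjoint_union_left] at hX
      have h2 : X ∈ nbr (b i) G ∩ nbr (b i) (swapFamily x y G) :=
        mem_inter.2 ⟨mem_nbr.2 ⟨hXc, A, hA, hX.1⟩,
          mem_nbr.2 ⟨hXc, _, mem_swapFamily.2 (by simpa using hA), hX.2⟩⟩
      have h3 := card_pos.2 ⟨X, h2⟩
      have h4 : nbr (b i) (∅ : Finset (Finset α)) = ∅ := by simp [nbr]
      rw [h4, card_empty]
      push_cast
      omega
    rw [hgz] at hsuper
    linarith
  · have hI : Admissible a c (G ∩ swapFamily x y G) :=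
      ⟨inter_subset_left.trans hGa, hne, B, hBc, fun A hA => hB A (mem_inter.1 hA).1⟩
    have hIle := hmax _ hI
    have hs := sum_nonneg hterm
    have hcard := hIle.2 (by linarith)
    have h1 : G ∩ swapFamily x y G = G := eq_of_subset_of_card_le inter_subset_left hcard
    exact (eq_of_subset_of_card_le (inter_eq_left.1 h1) (card_swapFamily x y G).le).symm

/-- `G` is invariant under transpositions preserving `A` or preserving `B`. If `A ≠ B`, a point of
`A \ B` and a point outside both link these into all transpositions, so `G` is the whole layer, and
some member misses `A`. -/
theorem Optimal.exists_unique_hitting (hG : Optimal ι b a c G) (hι : ι.Nonempty)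
    (hab : ∀ i ∈ ι, a + b i < Fintype.card α) (hac : a + c ≤ Fintype.card α)
    (hc : 2 * c < Fintype.card α) {A B : Finset α} (hAc : #A = c) (hBc : #B = c)
    (hA : ∀ X ∈ G, ¬ Disjoint X A) (hB : ∀ X ∈ G, ¬ Disjoint X B) : A = B := by
  by_contra hne
  have hfix : ∀ C : Finset α, #C = c → (∀ X ∈ G, ¬ Disjoint X C) → ∀ x y, (x ∈ C ↔ y ∈ C) →
      swapFamily x y G = G := fun C hCc hC x y hxy =>
    hG.swapFamily_eq hι hab hCc hC (by rwa [swapSet_eq_self hxy])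
  obtain ⟨x, hxA, hxB⟩ : ∃ x ∈ A, x ∉ B := by
    by_contra h
    push Not at h
    exact hne (eq_of_subset_of_card_le h (by omega))
  obtain ⟨z, hz⟩ : ∃ z, z ∉ A ∪ B := by
    by_contra h
    push Not at h
    have h1 := card_union_le A B
    rw [eq_univ_iff_forall.2 h, card_univ] at h1
    omega
  rw [mem_union, not_or] at hz
  have hx : ∀ w, swapFamily x w G = G := by
    intro w
    by_cases hwB : w ∈ B
    · by_cases hwA : w ∈ A
      · exact hfix A hAc hA x w (by simp [hxA, hwA])
      · exact swapFamily_trans (hfix B hBc hB x z (by simp [hxB, hz.2]))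
          (hfix A hAc hA z w (by simp [hwA, hz.1]))
    · exact hfix B hBc hB x w (by simp [hxB, hwB])
  have hall : ∀ u w, swapFamily u w G = G := fun u w =>
    swapFamily_trans (swapFamily_comm u x G ▸ hx u) (hx w)
  obtain ⟨X, hX⟩ := hG.1.2.1
  have hXc := (mem_powersetCard.1 (hG.1.1 hX)).2
  obtain ⟨Y, hY, hYc⟩ : ∃ Y ⊆ Aᶜ, #Y = a := exists_subset_card_eq (by rw [card_compl]; omega)
  refine hA Y ?_ (subset_compl_iff_disjoint_right.1 hY)
  refine exchange_induction Y (· ∈ G) (fun W hW y hyW _ x _ hxW => ?_) X hX (by omega)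
  rw [← swapSet_eq_insert hxW hyW, ← mem_swapFamily, hall]
  exact hW

theorem Optimal.compression (hG : Optimal ι b a c G) {S : Finset α} (hSc : #S = c)
    (hS : ∀ X ∈ G, ¬ Disjoint X S) {x y : α} (hx : x ∈ S) :
    Optimal ι b a c (UV.compression {x} {y} G) ∧
      ∀ X ∈ UV.compression {x} {y} G, ¬ Disjoint X S := by
  have hS' : ∀ X ∈ UV.compression {x} {y} G, ¬ Disjoint X S := by
    intro X hX
    rcases mem_compression_cases hX with ⟨hX, -⟩ | ⟨Y, -, -, hyY, rfl⟩
    · exact hS X hX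
    · intro hd
      exact disjoint_left.1 hd (mem_swapSet.2 (by simpa using hyY)) hx
  obtain ⟨⟨hGa, hGn, -⟩, h0, hmax⟩ := hG
  have hcard : #(UV.compression {x} {y} G) = #G := UV.card_compression _ _ _
  have hadm : Admissible a c (UV.compression {x} {y} G) := by
    refine ⟨?_, ?_, S, hSc, hS'⟩
    · intro X hX
      rcases mem_compression_cases hX with ⟨hX, -⟩ | ⟨Y, hY, -, -, rfl⟩
      · exact hGa hX
      · exact mem_powersetCard.2 ⟨subset_univ _, by
          rw [card_swapSet]; exact (mem_powersetCard.1 (hGa hY)).2⟩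
    · rw [← card_pos, hcard]; exact card_pos.2 hGn
  have hle : gain ι b G ≤ gain ι b (UV.compression {x} {y} G) := by
    have : ∑ i ∈ ι, (#(nbr (b i) (UV.compression {x} {y} G)) : ℤ) ≤
        ∑ i ∈ ι, (#(nbr (b i) G) : ℤ) :=
      sum_le_sum fun i _ => mod_cast card_nbr_compression_le (b i) x y G
    rw [gain, gain, hcard]
    linarith
  have heq := le_antisymm (hmax _ hadm).1 hle
  refine ⟨⟨hadm, by rwa [heq], fun G' hG' => ?_⟩, hS'⟩
  rw [heq, hcard]
  exact hmax G' hG'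

/-- Invariance within `S` and outside `S`, together with closure under moving a point into `S`, lets
one reach any set meeting `S` from a member that meets `S` in at most one prescribed point. -/
theorem Optimal.eq_hitting (hG : Optimal ι b a c G) (hι : ι.Nonempty)
    (hab : ∀ i ∈ ι, a + b i < Fintype.card α) (hac : a + c ≤ Fintype.card α)
    (hc : 2 * c < Fintype.card α) {S : Finset α} (hSc : #S = c)
    (hS : ∀ X ∈ G, ¬ Disjoint X S) :
    G = {X ∈ powersetCard a (univ : Finset α) | ¬ Disjoint X S} := by
  have hGa := hG.1.1
  have hfix : ∀ {G : Finset (Finset α)}, Optimal ι b a c G → (∀ X ∈ G, ¬ Disjoint X S) →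
      ∀ x y, (x ∈ S ↔ y ∈ S) → ∀ X ∈ G, swapSet x y X ∈ G := by
    intro G hG hS x y hxy X hX
    rw [← mem_swapFamily, hG.swapFamily_eq hι hab hSc hS (by rwa [swapSet_eq_self hxy])]
    exact hX
  -- The compressed family is optimal too, hence invariant within `S`. It keeps the copy of `X` with
  -- some `x' ∈ X ∩ S` exchanged for `x`, so it contains `X` itself, which is possible only if the
  -- shift of `X` was already in `G`.
  have hup : ∀ X ∈ G, ∀ x ∈ S, x ∉ X → ∀ y ∈ X, y ∉ S → insert x (X.erase y) ∈ G := by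
    intro X hX x hx hxX y hyX hyS
    by_contra hnot
    rw [← swapSet_eq_insert hxX hyX] at hnot
    obtain ⟨hopt, hS'⟩ := hG.compression hSc hS (y := y) hx
    obtain ⟨x', hx'X, hx'S⟩ := not_disjoint_iff.1 (hS X hX)
    have h1 : swapSet x x' X ∈ G := hfix hG hS x x' (by simp [hx, hx'S]) X hX
    have h2 : swapSet x x' X ∈ UV.compression {x} {y} G :=
      mem_compression_of_mem_of_not h1 (Or.inl (mem_swapSet.2 (by simpa using hx'X)))
    have h3 := hfix hopt hS' x x' (by simp [hx, hx'S]) _ h2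
    rw [swapSet_swapSet] at h3
    rcases mem_compression_cases h3 with ⟨-, h⟩ | ⟨Y, -, -, hyY, rfl⟩
    · exact hnot (h hxX hyX)
    · exact hxX (mem_swapSet.2 (by simpa using hyY))
  refine Subset.antisymm (fun X hX => mem_filter.2 ⟨hGa hX, hS X hX⟩) fun C hC => ?_
  rw [mem_filter, mem_powersetCard, not_disjoint_iff] at hC
  obtain ⟨⟨-, hCa⟩, x₁, hx₁C, hx₁S⟩ := hC
  obtain ⟨z, hz⟩ : ∃ z, z ∉ S := by
    by_contra h
    push Not at h
    rw [eq_univ_iff_forall.2 h, card_univ] at hSc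
    omega
  -- Otherwise replacing `x₁` by `z` in `S` would give a second `c`-set met by all of `G`.
  obtain ⟨X, hX, hXS⟩ : ∃ X ∈ G, X ∩ S ⊆ {x₁} := by
    have hcB : #(insert z (S.erase x₁)) = c := by
      rw [card_insert_of_notMem (by simp [hz]), card_erase_of_mem hx₁S, ← hSc]
      have := card_pos.2 ⟨x₁, hx₁S⟩
      omega
    have : ¬ ∀ X ∈ G, ¬ Disjoint X (insert z (S.erase x₁)) := fun h => by
      have h1 := hG.exists_unique_hitting hι hab hac hc hcB hSc h hS
      exact hz (h1 ▸ mem_insert_self _ _)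
    push Not at this
    obtain ⟨X, hX, hd⟩ := this
    refine ⟨X, hX, fun y hy => ?_⟩
    rw [mem_inter] at hy
    by_contra hne
    rw [mem_singleton] at hne
    exact disjoint_left.1 hd hy.1 (mem_insert_of_mem (mem_erase.2 ⟨hne, hy.2⟩))
  refine (exchange_induction C (fun X => X ∈ G ∧ X ∩ S ⊆ C) ?_ X ⟨hX, ?_⟩ ?_).1
  · rintro A ⟨hA, hAS⟩ y hyA hyC x hxC hxA
    have hyS : y ∉ S := fun h => hyC (hAS (mem_inter.2 ⟨hyA, h⟩))
    refine ⟨?_, ?_⟩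
    · by_cases hxS : x ∈ S
      · exact hup A hA x hxS hxA y hyA hyS
      · rw [← swapSet_eq_insert hxA hyA]
        exact hfix hG hS x y (by simp [hxS, hyS]) A hA
    · intro w hw
      rw [mem_inter, mem_insert, mem_erase] at hw
      rcases hw with ⟨rfl | hw, hwS⟩
      · exact hxC
      · exact hAS (mem_inter.2 ⟨hw.2, hwS⟩)
  · exact hXS.trans (singleton_subset_iff.2 hx₁C)
  · rw [(mem_powersetCard.1 (hGa hX)).2, hCa]

theorem card_powersetCard_disjoint (k : ℕ) (S : Finset α) :
    #({X ∈ powersetCard k univ | Disjoint X S} : Finset (Finset α)) =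
      (Fintype.card α - #S).choose k := by
  rw [← card_compl, ← card_powersetCard]
  congr 1
  ext X
  simp [mem_powersetCard, subset_compl_iff_disjoint_right, and_comm]

theorem card_powersetCard_not_disjoint (k : ℕ) (S : Finset α) :
    #({X ∈ powersetCard k univ | ¬ Disjoint X S} : Finset (Finset α)) =
      (Fintype.card α).choose k - (Fintype.card α - #S).choose k := by
  have h := card_filter_add_card_filter_not (s := powersetCard k (univ : Finset α))
    (fun X => Disjoint X S)
  rw [card_powersetCard_disjoint, card_powersetCard, card_univ] at h
  omega

theorem card_powersetCard_superset {k : ℕ} {S : Finset α} (hk : #S ≤ k) :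
    #({X ∈ powersetCard k univ | S ⊆ X} : Finset (Finset α)) =
      (Fintype.card α - #S).choose (k - #S) := by
  rw [← card_compl, ← card_powersetCard]
  refine card_nbij' (fun X => X \ S) (fun X => X ∪ S) ?_ ?_ ?_ ?_
  · intro X hX
    simp only [coe_filter, mem_powersetCard, Set.mem_ofPred_eq] at hX
    simp only [mem_coe, mem_powersetCard]
    exact ⟨fun z hz => mem_compl.2 (mem_sdiff.1 hz).2, by
      rw [card_sdiff_of_subset hX.2, hX.1.2]⟩
  · intro X hX
    simp only [mem_coe, mem_powersetCard] at hX
    simp only [coe_filter, mem_powersetCard, Set.mem_ofPred_eq]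
    refine ⟨⟨subset_univ _, ?_⟩, subset_union_right⟩
    rw [card_union_of_disjoint (subset_compl_iff_disjoint_right.1 hX.1), hX.2]
    omega
  · intro X hX
    simp only [coe_filter, mem_powersetCard, Set.mem_ofPred_eq] at hX
    exact sdiff_union_of_subset hX.2
  · intro X hX
    simp only [mem_coe, mem_powersetCard] at hX
    exact union_sdiff_cancel_right (subset_compl_iff_disjoint_right.1 hX.1)

/-- A `k`-set is disjoint from some `a`-set meeting `S` exactly when it does not contain `S`. -/
theorem card_nbr_hitting {a k : ℕ} (hk : a + k ≤ Fintype.card α) (ha : 1 ≤ a) {S : Finset α}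
    (hSk : #S ≤ k) :
    (#(nbr k {X ∈ powersetCard a (univ : Finset α) | ¬ Disjoint X S}) : ℤ) =
      (Fintype.card α).choose k - (Fintype.card α - #S).choose (k - #S) := by
  have h : nbr k {X ∈ powersetCard a (univ : Finset α) | ¬ Disjoint X S} =
      {X ∈ powersetCard k (univ : Finset α) | ¬ S ⊆ X} := by
    ext Y
    simp only [mem_nbr, mem_filter, mem_powersetCard, subset_univ, true_and]
    refine and_congr_right fun hY => ⟨?_, fun h => ?_⟩
    · rintro ⟨X, ⟨-, hX⟩, hd⟩ hSY
      exact hX (hd.mono_right hSY)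
    · obtain ⟨x, hxS, hxY⟩ := not_subset.1 h
      obtain ⟨X, hxX, hXY, hXc⟩ := exists_subsuperset_card_eq
        (s := {x}) (t := Yᶜ) (n := a) (by simpa using hxY) (by simpa using ha)
        (by rw [card_compl]; omega)
      exact ⟨X, ⟨hXc, not_disjoint_iff.2 ⟨x, by simpa using hxX, hxS⟩⟩,
        subset_compl_iff_disjoint_right.1 hXY⟩
  have h2 := card_filter_add_card_filter_not (s := powersetCard k (univ : Finset α))
    (fun X => S ⊆ X)
  rw [card_powersetCard_superset hSk, card_powersetCard, card_univ] at h2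
  rw [h]
  omega

/-- An admissible family of non-negative gain has gain at most that of a hitting family, with
equality only if it has the same size. -/
theorem gain_le_hitting (hG : Admissible a c G) (h0 : 0 ≤ gain ι b G)
    (hab : ∀ i ∈ ι, a + b i < Fintype.card α) (hba : ∀ i ∈ ι, b i < a)
    (hcb : ∀ i ∈ ι, c ≤ b i) (hcι : ∃ i ∈ ι, b i = c) :
    gain ι b G ≤ (Fintype.card α).choose a - (Fintype.card α - c).choose a -
        ∑ i ∈ ι, (((Fintype.card α).choose (b i) : ℤ) - (Fintype.card α - c).choose (b i - c)) ∧
      (gain ι b G = (Fintype.card α).choose a - (Fintype.card α - c).choose a -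
        ∑ i ∈ ι, (((Fintype.card α).choose (b i) : ℤ) - (Fintype.card α - c).choose (b i - c)) →
        #G = (Fintype.card α).choose a - (Fintype.card α - c).choose a) := by
  classical
  obtain ⟨i₀, hi₀, hi₀c⟩ := hcι
  have hι : ι.Nonempty := ⟨i₀, hi₀⟩
  have hac : a + c < Fintype.card α := hi₀c ▸ hab i₀ hi₀
  have hca : c < a := hi₀c ▸ hba i₀ hi₀
  obtain ⟨M, hM, hMmax⟩ := exists_max_image ({G | Admissible a c G} : Finset (Finset (Finset α)))
    (gain ι b) ⟨G, by simpa using hG⟩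
  obtain ⟨O, hO, hOmin⟩ := exists_min_image
    ({G | Admissible a c G ∧ gain ι b G = gain ι b M} : Finset (Finset (Finset α))) card
    ⟨M, by simpa using hM⟩
  simp only [mem_filter, mem_univ, true_and] at hM hMmax hO hOmin
  have hopt : Optimal ι b a c O := by
    refine ⟨hO.1, ?_, fun G' hG' => ⟨?_, fun h => ?_⟩⟩
    · rw [hO.2]; exact h0.trans (hMmax G hG)
    · rw [hO.2]; exact hMmax G' hG'
    · exact hOmin G' ⟨hG', h.trans hO.2⟩
  obtain ⟨S, hSc, hS⟩ := hO.1.2.2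
  have hOeq := hopt.eq_hitting hι hab hac.le (by omega) hSc hS
  have hle : (Fintype.card α - c).choose a ≤ (Fintype.card α).choose a :=
    Nat.choose_le_choose a (Nat.sub_le _ _)
  have hOc : #O = (Fintype.card α).choose a - (Fintype.card α - c).choose a := by
    rw [hOeq, card_powersetCard_not_disjoint, hSc]
  have hgO : gain ι b O = (Fintype.card α).choose a - (Fintype.card α - c).choose a -
      ∑ i ∈ ι, (((Fintype.card α).choose (b i) : ℤ) -
        (Fintype.card α - c).choose (b i - c)) := by
    rw [gain, hOc, Nat.cast_sub hle]
    congr 1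
    refine sum_congr rfl fun i hi => ?_
    rw [hOeq, card_nbr_hitting (hab i hi).le (by omega) (by rw [hSc]; exact hcb i hi), hSc]
  rw [← hgO, ← hOc]
  refine ⟨(hopt.2.2 G hG).1, fun h => le_antisymm ?_ ((hopt.2.2 G hG).2 h)⟩
  -- Minimality bounds the optimal size by #G; conversely `G` sits inside the hitting family of its
  -- own `c`-set.
  obtain ⟨S', hSc', hS'⟩ := hG.2.2
  rw [hOc, ← hSc', ← card_powersetCard_not_disjoint]
  exact card_le_card fun X hX => mem_filter.2 ⟨hG.1 hX, hS' X hX⟩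

end Gain

/-! ### Double counting in the disjointness graph of two layers. -/

section Regular

/-- Compares the two degrees of the disjointness graph: by symmetry both have lower index `m - a -
b`. -/
theorem choose_sub_le_choose_sub {a b m : ℕ} (hab : a + b ≤ m) (h : a ≤ b ∨ a + b = m) :
    (m - b).choose a ≤ (m - a).choose b := by
  rw [← Nat.choose_symm_of_eq_add (show m - b = m - a - b + a by omega),
    ← Nat.choose_symm_of_eq_add (show m - a = m - a - b + b by omega)]
  rcases h with h | h
  · exact Nat.choose_le_choose _ (by omega)
  · have : m - a - b = 0 := by omega
    simp [this]

variable {α : Type*} [Fintype α] [DecidableEq α] {a b : ℕ} {G : Finset (Finset α)}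

theorem sum_card_disjoint_nbr (hG : G ⊆ powersetCard a univ) :
    ∑ B ∈ nbr b G, #{A ∈ G | Disjoint A B} = #G * (Fintype.card α - a).choose b := by
  have h := sum_card_bipartiteAbove_eq_sum_card_bipartiteBelow
    (s := G) (t := nbr b G) (fun A B => Disjoint A B)
  rw [sum_congr rfl (g := fun _ => (Fintype.card α - a).choose b)] at h
  · rw [sum_const, smul_eq_mul] at h
    exact h.symm
  · intro A hA
    rw [← (mem_powersetCard.1 (hG hA)).2, ← card_powersetCard_disjoint]
    congr 1
    ext B
    simp only [mem_bipartiteAbove, mem_nbr, mem_filter, mem_powersetCard, subset_univ, true_and]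
    exact ⟨fun h => ⟨h.1.1, h.2.symm⟩, fun h => ⟨⟨h.1, A, hA, h.2.symm⟩, h.2.symm⟩⟩

theorem card_disjoint_le (hG : G ⊆ powersetCard a univ) {B : Finset α} (hB : #B = b) :
    #{A ∈ G | Disjoint A B} ≤ (Fintype.card α - b).choose a := by
  rw [← hB, ← card_powersetCard_disjoint]
  exact card_le_card (filter_subset_filter _ hG)

theorem card_le_card_nbr (hG : G ⊆ powersetCard a univ) (hab : a + b ≤ Fintype.card α)
    (h : a ≤ b ∨ a + b = Fintype.card α) : #G ≤ #(nbr b G) := by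
  have h1 : ∑ B ∈ nbr b G, #{A ∈ G | Disjoint A B} ≤
      ∑ _B ∈ nbr b G, (Fintype.card α - b).choose a :=
    sum_le_sum fun B hB => card_disjoint_le hG (mem_nbr.1 hB).1
  rw [sum_card_disjoint_nbr hG, sum_const, smul_eq_mul] at h1
  have h2 := Nat.mul_le_mul_left (#(nbr b G)) (choose_sub_le_choose_sub hab h)
  exact Nat.le_of_mul_le_mul_right (h1.trans h2) (Nat.choose_pos (by omega))

/-- Equality makes `G` a union of connected components. As `a + b < card α`, sets differing by one
exchange have a common neighbour, so the graph is connected on `a`-sets and `G` is the whole layer.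
-/
theorem card_lt_card_nbr (hG : G ⊆ powersetCard a univ) (hab : a + b < Fintype.card α)
    (h : a ≤ b) (hne : G.Nonempty) (hnbr : nbr b G ≠ powersetCard b univ) :
    #G < #(nbr b G) := by
  by_contra hle
  have heq := le_antisymm (card_le_card_nbr hG hab.le (Or.inl h)) (not_lt.1 hle)
  have h1 : ∀ B ∈ nbr b G, #{A ∈ G | Disjoint A B} ≤ (Fintype.card α - b).choose a :=
    fun B hB => card_disjoint_le hG (mem_nbr.1 hB).1
  have h2 : ∀ B ∈ nbr b G, #{A ∈ G | Disjoint A B} = (Fintype.card α - b).choose a := by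
    rw [← sum_eq_sum_iff_of_le h1]
    refine le_antisymm (sum_le_sum h1) ?_
    rw [sum_card_disjoint_nbr hG, sum_const, smul_eq_mul, ← heq]
    exact Nat.mul_le_mul_left _ (choose_sub_le_choose_sub hab.le (Or.inl h))
  have h3 : ∀ B ∈ nbr b G, ∀ A : Finset α, #A = a → Disjoint A B → A ∈ G := by
    intro B hB A hA hAB
    have h4 := h2 B hB
    rw [← (mem_nbr.1 hB).1, ← card_powersetCard_disjoint] at h4
    have h5 := eq_of_subset_of_card_le (filter_subset_filter (fun A => Disjoint A B) hG) h4.ge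
    have h6 : A ∈ ({A ∈ G | Disjoint A B} : Finset (Finset α)) := by
      rw [h5]
      exact mem_filter.2 ⟨mem_powersetCard.2 ⟨subset_univ _, hA⟩, hAB⟩
    exact (mem_filter.1 h6).1
  obtain ⟨A₀, hA₀⟩ := hne
  have hcard : ∀ A ∈ G, #A = a := fun A hA => (mem_powersetCard.1 (hG hA)).2
  have hall : ∀ C : Finset α, #C = a → C ∈ G := by
    intro C hC
    refine exchange_induction C (· ∈ G) (fun A hA y hyA _ x _ hxA => ?_) A₀ hA₀
      (by rw [hC, hcard A₀ hA₀])
    obtain ⟨B, hB, hBc⟩ : ∃ B ⊆ (insert x A)ᶜ, #B = b := exists_subset_card_eq (by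
      rw [card_compl, card_insert_of_notMem hxA, hcard A hA]; omega)
    rw [subset_compl_iff_disjoint_left] at hB
    refine h3 B (mem_nbr.2 ⟨hBc, A, hA, hB.mono_left (subset_insert x A)⟩) _ ?_ ?_
    · rw [card_insert_of_notMem (by simp [hxA]), card_erase_of_mem hyA, hcard A hA]
      have := card_pos.2 ⟨y, hyA⟩
      have := hcard A hA
      omega
    · exact hB.mono_left (insert_subset_insert x (erase_subset y A))
  apply hnbr
  refine Subset.antisymm (nbr_subset b G) fun B hB => ?_
  have hBc := (mem_powersetCard.1 hB).2
  obtain ⟨A, hA, hAc⟩ : ∃ A ⊆ Bᶜ, #A = a := exists_subset_card_eq (by rw [card_compl]; omega)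
  exact mem_nbr.2 ⟨hBc, A, hall A hAc, subset_compl_iff_disjoint_right.1 hA⟩

end Regular

/-! ### Splitting a large family into a star and a remainder. -/

section Reduction

open Finset.Colex
open scoped FinsetFamily

theorem exists_isInitSeg_card {n s : ℕ} (N : ℕ) (hN : N ≤ n.choose s) :
    ∃ C : Finset (Finset (Fin n)), IsInitSeg C s ∧ #C = N := by
  induction N with
  | zero => exact ⟨∅, isInitSeg_empty, card_empty⟩
  | succ N ih =>
    obtain ⟨C, hC, hCN⟩ := ih (by omega)
    have hsub : C ⊆ powersetCard s univ := fun X hX =>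
      mem_powersetCard.2 ⟨subset_univ _, hC.1 hX⟩
    have hne : (powersetCard s univ \ C).Nonempty := by
      rw [← card_pos, card_sdiff_of_subset hsub, card_powersetCard, card_univ, Fintype.card_fin]
      omega
    obtain ⟨X, hX, hmin⟩ := exists_min_image (powersetCard s univ \ C) toColex hne
    rw [mem_sdiff, mem_powersetCard] at hX
    refine ⟨insert X C, ⟨?_, ?_⟩, by rw [card_insert_of_notMem hX.2, hCN]⟩
    · intro Y hY
      rcases mem_insert.1 hY with rfl | hY
      · exact hX.1.2
      · exact hC.1 hY
    · rintro Y Z hY ⟨hlt, hZ⟩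
      rcases mem_insert.1 hY with rfl | hY
      · by_contra hZC
        rw [mem_insert, not_or] at hZC
        exact absurd (hmin Z (mem_sdiff.2 ⟨mem_powersetCard.2 ⟨subset_univ _, hZ⟩, hZC.2⟩))
          (not_le.2 hlt)
      · exact mem_insert_of_mem (hC.2 hY ⟨hlt, hZ⟩)

/-- There are only C(m, s) sets avoiding the last point, so `C` has a member containing it, and in
colex order that member follows every set avoiding it. -/
theorem mem_initSeg_of_last_notMem {m s : ℕ} {C : Finset (Finset (Fin (m + 1)))}
    (hC : IsInitSeg C s) (hcard : m.choose s < #C) {X : Finset (Fin (m + 1))} (hX : #X = s)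
    (hlast : Fin.last m ∉ X) : X ∈ C := by
  obtain ⟨Y, hY, hYl⟩ : ∃ Y ∈ C, Fin.last m ∈ Y := by
    by_contra h
    push Not at h
    have h1 : C ⊆ powersetCard s (univ.erase (Fin.last m)) := fun Y hY =>
      mem_powersetCard.2 ⟨fun z hz => mem_erase.2 ⟨fun e => h Y hY (e ▸ hz), mem_univ _⟩,
        hC.1 hY⟩
    have h2 := card_le_card h1
    rw [card_powersetCard, card_erase_of_mem (mem_univ _), card_univ, Fintype.card_fin,
      Nat.add_sub_cancel] at h2
    omega
  refine hC.2 hY ⟨?_, hX⟩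
  rw [toColex_lt_toColex]
  refine ⟨fun e => hlast (e ▸ hYl), fun z _ _ => ⟨Fin.last m, hYl, hlast, Fin.le_last z⟩⟩

/-- A family of more than `C(m, k-1)` sets of size `k` on `m + 1` points has at least the
neighbourhoods of a full star together with a family `G` of `k`-sets on `m` points. -/
theorem exists_link_family {m k : ℕ} (hk : 1 ≤ k) {F : Finset (Finset (Fin (m + 1)))}
    (hF : F ⊆ powersetCard k univ) (hcard : m.choose (k - 1) < #F) :
    ∃ G : Finset (Finset (Fin m)), G ⊆ powersetCard k univ ∧ #F = m.choose (k - 1) + #G ∧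
      ∀ l, 1 ≤ l → k + l ≤ m + 1 → m.choose l + #(nbr (l - 1) G) ≤ #(nbr l F) := by
  have hFk : ∀ A ∈ F, #A = k := fun A hA => (mem_powersetCard.1 (hF hA)).2
  have hkm : k ≤ m + 1 := by
    obtain ⟨A, hA⟩ : F.Nonempty := card_pos.1 (by omega)
    have := card_le_univ A
    rwa [hFk A hA, Fintype.card_fin] at this
  obtain ⟨s, hs⟩ : ∃ s, s + k = m + 1 := ⟨m + 1 - k, by omega⟩
  have hFle : #F ≤ (m + 1).choose s := by
    have := card_le_card hF
    rwa [card_powersetCard, card_univ, Fintype.card_fin,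
      ← Nat.choose_symm_of_eq_add hs.symm] at this
  obtain ⟨C, hC, hCF⟩ := exists_isInitSeg_card (#F) hFle
  have hsm : m.choose (k - 1) = m.choose s :=
    Nat.choose_symm_of_eq_add (by omega)
  have hCl : ∀ X : Finset (Fin (m + 1)), #X = s → Fin.last m ∉ X → X ∈ C := fun X hX hl =>
    mem_initSeg_of_last_notMem hC (by omega) hX hl
  set e : Finset (Fin m) → Finset (Fin (m + 1)) := fun A => A.map Fin.castSuccEmb with he
  have he_inj : Function.Injective e := map_injective _
  have hel : ∀ A, Fin.last m ∉ e A := by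
    intro A h
    obtain ⟨z, -, hz⟩ := mem_map.1 h
    exact (Fin.castSucc_ne_last z) hz
  have hec : ∀ A, #(e A) = #A := fun A => card_map _
  have hed : ∀ A B, Disjoint (e A) (e B) ↔ Disjoint A B := fun A B => disjoint_map _
  have hes : ∀ X : Finset (Fin (m + 1)), Fin.last m ∉ X → ∃ A, e A = X := by
    intro X hX
    refine ⟨({z | Fin.castSucc z ∈ X} : Finset (Fin m)), ?_⟩
    ext w
    simp only [he, mem_map, mem_filter, mem_univ, true_and, Fin.coe_castSuccEmb]
    constructor
    · rintro ⟨z, hz, rfl⟩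
      exact hz
    · intro hw
      have hwl : w ≠ Fin.last m := fun h => hX (h ▸ hw)
      exact ⟨w.castPred hwl, by simpa using hw, by simp⟩
  -- The members of `C` avoiding the last point account for the star; `G` consists of the
  -- complements of the others.
  refine ⟨{A ∈ powersetCard k (univ : Finset (Fin m)) | (e A)ᶜ ∈ C}, filter_subset _ _, ?_, ?_⟩
  · have h1 := card_filter_add_card_filter_not (s := C) (fun X => Fin.last m ∈ X)
    have h2 : #{X ∈ C | Fin.last m ∉ X} = m.choose s := by
      have : ({X ∈ C | Fin.last m ∉ X} : Finset (Finset (Fin (m + 1)))) =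
          powersetCard s (univ.erase (Fin.last m)) := by
        ext X
        rw [mem_filter, mem_powersetCard]
        constructor
        · rintro ⟨hX, hl⟩
          exact ⟨fun z hz => mem_erase.2 ⟨fun h => hl (h ▸ hz), mem_univ _⟩, hC.1 hX⟩
        · rintro ⟨hX, hXs⟩
          have hl : Fin.last m ∉ X := fun h => (mem_erase.1 (hX h)).1 rfl
          exact ⟨hCl X hXs hl, hl⟩
      rw [this, card_powersetCard, card_erase_of_mem (mem_univ _), card_univ, Fintype.card_fin,
        Nat.add_sub_cancel]
    have h3 : #{X ∈ C | Fin.last m ∈ X} =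
        #({A ∈ powersetCard k univ | (e A)ᶜ ∈ C} : Finset (Finset (Fin m))) := by
      symm
      refine card_bij (fun A _ => (e A)ᶜ) ?_ ?_ ?_
      · intro A hA
        exact mem_filter.2 ⟨(mem_filter.1 hA).2, mem_compl.2 (hel A)⟩
      · intro A _ B _ hAB
        exact he_inj (compl_injective hAB)
      · intro X hX
        rw [mem_filter] at hX
        obtain ⟨A, hA⟩ := hes Xᶜ (by simpa using hX.2)
        have hXs : #X = s := hC.1 hX.1
        refine ⟨A, mem_filter.2 ⟨mem_powersetCard.2 ⟨subset_univ _, ?_⟩, ?_⟩, ?_⟩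
        · rw [← hec, hA, card_compl, Fintype.card_fin, hXs]; omega
        · rw [hA, compl_compl]; exact hX.1
        · rw [hA, compl_compl]
    omega
  · intro l hl hkl
    -- Being disjoint from `A` means lying inside its complement, so neighbourhoods are iterated
    -- shadows of complements.
    have hshadow : nbr l F = ∂^[s - l] (F.image compl) := by
      ext B
      rw [mem_nbr, mem_shadow_iterate_iff_exists_mem_card_add]
      constructor
      · rintro ⟨hB, A, hA, hd⟩
        refine ⟨Aᶜ, mem_image_of_mem _ hA, subset_compl_iff_disjoint_left.2 hd, ?_⟩
        rw [card_compl, Fintype.card_fin, hFk A hA, hB]; omega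
      · rintro ⟨X, hX, hBX, hXB⟩
        obtain ⟨A, hA, rfl⟩ := mem_image.1 hX
        rw [card_compl, Fintype.card_fin, hFk A hA] at hXB
        exact ⟨by omega, A, hA, subset_compl_iff_disjoint_left.1 hBX⟩
    have hsized : ((F.image compl : Finset (Finset (Fin (m + 1)))) :
        Set (Finset (Fin (m + 1)))).Sized s := by
      intro X hX
      obtain ⟨A, hA, rfl⟩ := mem_image.1 (mem_coe.1 hX)
      rw [card_compl, Fintype.card_fin, hFk A hA]; omega
    have hkk := iterated_kk (k := s - l) hsized
      (by rw [card_image_of_injective _ compl_injective, hCF]) hC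
    rw [← hshadow] at hkk
    refine le_trans ?_ hkk
    set G : Finset (Finset (Fin m)) := {A ∈ powersetCard k univ | (e A)ᶜ ∈ C}
    have h1 : #(powersetCard l (univ.erase (Fin.last m))) = m.choose l := by
      rw [card_powersetCard, card_erase_of_mem (mem_univ _), card_univ, Fintype.card_fin,
        Nat.add_sub_cancel]
    have hinj : Function.Injective (fun B => insert (Fin.last m) (e B)) := by
      intro B B' h
      have := congrArg (fun X => X.erase (Fin.last m)) h
      simp only [erase_insert (hel _)] at this
      exact he_inj this
    rw [← h1, ← card_image_of_injective (nbr (l - 1) G) hinj, ← card_union_of_disjoint]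
    · apply card_le_card
      intro B hB
      rw [mem_shadow_iterate_iff_exists_mem_card_add]
      rcases mem_union.1 hB with hB | hB
      · rw [mem_powersetCard] at hB
        obtain ⟨X, hBX, hX, hXs⟩ := exists_subsuperset_card_eq (n := s) hB.1 (by omega) (by
          rw [card_erase_of_mem (mem_univ _), card_univ, Fintype.card_fin]; omega)
        exact ⟨X, hCl X hXs fun h => (mem_erase.1 (hX h)).1 rfl, hBX, by omega⟩
      · obtain ⟨B', hB', rfl⟩ := mem_image.1 hB
        obtain ⟨hB'c, A, hA, hd⟩ := mem_nbr.1 hB'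
        have hAk := (mem_powersetCard.1 (mem_filter.1 hA).1).2
        refine ⟨(e A)ᶜ, (mem_filter.1 hA).2, ?_, ?_⟩
        · rw [subset_compl_iff_disjoint_left, disjoint_insert_right]
          exact ⟨hel A, (hed A B').2 hd⟩
        · rw [card_compl, Fintype.card_fin, hec, hAk, card_insert_of_notMem (hel B'), hec, hB'c]
          omega
    · rw [disjoint_left]
      intro B hB hB'
      obtain ⟨B', -, rfl⟩ := mem_image.1 hB'
      exact (mem_erase.1 ((mem_powersetCard.1 hB).1 (mem_insert_self _ _))).1 rfl

end Reduction

/-! ### Total sizes: equality for stars, and one large family. -/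

section Configuration

variable {m : ℕ} {I : Finset ℕ} {k : ℕ → ℕ} {F : ℕ → Finset (Finset (Fin (m + 1)))}

theorem subset_star_of_cross {p l : ℕ} (hp : 1 ≤ p) (hpl : p + l ≤ m + 1)
    {A B : Finset (Finset (Fin (m + 1)))} {x : Fin (m + 1)} (hB : B ⊆ powersetCard l univ)
    (hA : A = {X ∈ powersetCard p (univ : Finset (Fin (m + 1))) | x ∈ X})
    (hcross : ∀ X ∈ A, ∀ Y ∈ B, ¬ Disjoint X Y) :
    B ⊆ {X ∈ powersetCard l (univ : Finset (Fin (m + 1))) | x ∈ X} := by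
  intro Y hY
  refine mem_filter.2 ⟨hB hY, ?_⟩
  by_contra hx
  have hYl := (mem_powersetCard.1 (hB hY)).2
  obtain ⟨X, hxX, hXY, hXp⟩ := exists_subsuperset_card_eq (s := {x}) (t := Yᶜ) (n := p)
    (by simpa using hx) (by simpa using hp) (by rw [card_compl, Fintype.card_fin]; omega)
  refine hcross X ?_ Y hY (subset_compl_iff_disjoint_right.1 hXY)
  rw [hA]
  exact mem_filter.2 ⟨mem_powersetCard.2 ⟨subset_univ _, hXp⟩, hxX (mem_singleton_self x)⟩

theorem card_star {l : ℕ} (hl : 1 ≤ l) (x : Fin (m + 1)) :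
    #{X ∈ powersetCard l (univ : Finset (Fin (m + 1))) | x ∈ X} = m.choose (l - 1) := by
  have h := card_powersetCard_superset (k := l) (S := {x}) (by simpa using hl)
  simpa using h

/-- Families which are at most as large as stars, with total size that of stars, are stars. -/
theorem eq_stars_of_card_le (hF : ∀ i ∈ I, F i ⊆ powersetCard (k i) univ)
    (hpos : ∀ i ∈ I, 1 ≤ k i) (hpair : ∀ i ∈ I, ∀ j ∈ I, i ≠ j → k i + k j ≤ m + 1)
    (hcross : ∀ i ∈ I, ∀ j ∈ I, i ≠ j → ∀ A ∈ F i, ∀ B ∈ F j, ¬ Disjoint A B)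
    (hle : ∀ i ∈ I, #(F i) ≤ m.choose (k i - 1))
    (hsum : ∑ i ∈ I, #(F i) = ∑ i ∈ I, m.choose (k i - 1))
    {p q : ℕ} (hp : p ∈ I) (hq : q ∈ I) (hpq : p ≠ q) (hpqm : k p + k q ≤ m) :
    ∃ x, ∀ i ∈ I, F i = {X ∈ powersetCard (k i) (univ : Finset (Fin (m + 1))) | x ∈ X} := by
  have heq := (sum_eq_sum_iff_of_le hle).1 hsum
  obtain ⟨x, hx⟩ := eq_star_of_card_eq (hpos p hp) (hpos q hq) hpqm (Fintype.card_fin _)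
    (hF p hp) (hF q hq) (hcross p hp q hq hpq) (heq p hp) (heq q hq)
  refine ⟨x, fun i hi => ?_⟩
  rcases eq_or_ne i p with rfl | hip
  · exact hx
  · refine eq_of_subset_of_card_le (subset_star_of_cross (hpos p hp) (hpair p hp i hi hip.symm)
      (hF i hi) hx (hcross p hp i hi hip.symm)) ?_
    rw [card_star (hpos i hi), heq i hi]

/-- `F i` avoids the neighbourhood of `F j`; after Pascal's rule the bound on that neighbourhood
becomes a deficit of #nbr from the size of a star. Non-emptiness of `F i` keeps this neighbourhood
of `G` proper. -/
theorem exists_reduced_family (hF : ∀ i ∈ I, F i ⊆ powersetCard (k i) univ)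
    (hne : ∀ i ∈ I, (F i).Nonempty)
    (hpos : ∀ i ∈ I, 1 ≤ k i) (hpair : ∀ i ∈ I, ∀ j ∈ I, i ≠ j → k i + k j ≤ m + 1)
    (hcross : ∀ i ∈ I, ∀ j ∈ I, i ≠ j → ∀ A ∈ F i, ∀ B ∈ F j, ¬ Disjoint A B)
    {j : ℕ} (hj : j ∈ I) (hbig : m.choose (k j - 1) < #(F j)) :
    ∃ G : Finset (Finset (Fin m)), G ⊆ powersetCard (k j) univ ∧ G.Nonempty ∧
      #(F j) = m.choose (k j - 1) + #G ∧
      (∀ i ∈ I.erase j, nbr (k i - 1) G ≠ powersetCard (k i - 1) univ) ∧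
      ((∑ i ∈ I, #(F i) : ℕ) : ℤ) ≤ (∑ i ∈ I, m.choose (k i - 1) : ℕ) +
        gain (I.erase j) (fun i => k i - 1) G := by
  obtain ⟨G, hG, hGc, hnbr⟩ := exists_link_family (hpos j hj) (hF j hj) hbig
  have hle : ∀ i ∈ I.erase j, #(F i) + #(nbr (k i - 1) G) ≤ m.choose (k i - 1) := by
    intro i hi
    rw [mem_erase] at hi
    have h1 := hnbr (k i) (hpos i hi.2) (hpair j hj i hi.2 hi.1.symm)
    have h2 := card_nbr_add_le (hF i hi.2) (hcross i hi.2 j hj hi.1)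
    obtain ⟨l, hl⟩ : ∃ l, k i = l + 1 := ⟨k i - 1, by have := hpos i hi.2; omega⟩
    rw [Fintype.card_fin, hl, Nat.choose_succ_succ] at h2
    rw [hl] at h1 ⊢
    simp only [Nat.add_sub_cancel, Nat.succ_eq_add_one] at *
    omega
  refine ⟨G, hG, card_pos.1 (by omega), hGc, fun i hi h => ?_, ?_⟩
  · have h1 := hle i hi
    rw [h, card_powersetCard, card_univ, Fintype.card_fin] at h1
    have := card_pos.2 (hne i (mem_of_mem_erase hi))
    omega
  · have h1 := sum_le_sum hle
    rw [sum_add_distrib] at h1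
    rw [← add_sum_erase I _ hj, ← add_sum_erase I _ hj, gain]
    zify at h1 hGc
    push_cast
    linarith

/-- If a family exceeds a star and some other layer is at least as large, the total size is less
than that of stars. -/
theorem sum_lt_of_big_of_large_layer (hF : ∀ i ∈ I, F i ⊆ powersetCard (k i) univ)
    (hne : ∀ i ∈ I, (F i).Nonempty)
    (hpos : ∀ i ∈ I, 1 ≤ k i) (hpair : ∀ i ∈ I, ∀ j ∈ I, i ≠ j → k i + k j ≤ m + 1)
    (hcross : ∀ i ∈ I, ∀ j ∈ I, i ≠ j → ∀ A ∈ F i, ∀ B ∈ F j, ¬ Disjoint A B)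
    {i j : ℕ} (hj : j ∈ I) (hbig : m.choose (k j - 1) < #(F j)) (hi : i ∈ I) (hij : i ≠ j)
    (hlarge : k j ≤ k i - 1 ∨ k j + (k i - 1) = m)
    (hstrict : (∃ l ∈ I, l ≠ i ∧ l ≠ j) ∨ (k j ≤ k i - 1 ∧ k j + (k i - 1) < m)) :
    ∑ i ∈ I, #(F i) < ∑ i ∈ I, m.choose (k i - 1) := by
  obtain ⟨G, hG, hGne, -, hadm, hle⟩ := exists_reduced_family hF hne hpos hpair hcross hj hbig
  have hI : i ∈ I.erase j := mem_erase.2 ⟨hij, hi⟩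
  have hpm : ∀ l ∈ I.erase j, k j + (k l - 1) ≤ m := by
    intro l hl
    rw [mem_erase] at hl
    have := hpair j hj l hl.2 hl.1.symm
    have := hpos l hl.2
    omega
  have hi1 : #G ≤ #(nbr (k i - 1) G) :=
    card_le_card_nbr hG (by rw [Fintype.card_fin]; exact hpm i hI) (by rwa [Fintype.card_fin])
  have h : #G < ∑ l ∈ I.erase j, #(nbr (k l - 1) G) := by
    rcases hstrict with ⟨l, hl, hli, hlj⟩ | ⟨h1, h2⟩
    -- A third family contributes at least one further neighbour, which already gives strictness.
    · have hL : l ∈ (I.erase j).erase i := mem_erase.2 ⟨hli, mem_erase.2 ⟨hlj, hl⟩⟩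
      have hpos' : 0 < #(nbr (k l - 1) G) := by
        obtain ⟨A, hA⟩ := hGne
        obtain ⟨B, hB, hBc⟩ : ∃ B ⊆ Aᶜ, #B = k l - 1 := exists_subset_card_eq (by
          have := hpm l (mem_of_mem_erase hL)
          rw [card_compl, Fintype.card_fin, (mem_powersetCard.1 (hG hA)).2]
          omega)
        exact card_pos.2 ⟨B, mem_nbr.2 ⟨hBc, A, hA, subset_compl_iff_disjoint_left.1 hB⟩⟩
      rw [← add_sum_erase _ _ hI, ← add_sum_erase _ _ hL]
      omega
    · have := card_lt_card_nbr hG (by rwa [Fintype.card_fin]) h1 hGne (hadm i hI)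
      exact this.trans_le
        (single_le_sum (f := fun l => #(nbr (k l - 1) G)) (fun _ _ => Nat.zero_le _) hI)
  rw [gain] at hle
  zify at h ⊢
  push_cast at hle
  linarith

theorem card_hitting_total {j ρ : ℕ} (hj : j ∈ I) (hρ : ρ ∈ I) (hpos : ∀ i ∈ I, 1 ≤ k i)
    (hkρ : k ρ ≤ m + 1) :
    ((∑ i ∈ I, m.choose (k i - 1) : ℕ) : ℤ) + (m.choose (k j) -
        (m - (k ρ - 1)).choose (k j) - ∑ i ∈ I.erase j,
          ((m.choose (k i - 1) : ℤ) - (m - (k ρ - 1)).choose (k i - 1 - (k ρ - 1)))) =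
      (((m + 1).choose (k j) - (m + 1 - k ρ).choose (k j) +
        ∑ i ∈ I.erase j, (m + 1 - k ρ).choose (k i - k ρ) : ℕ) : ℤ) := by
  have h1 : m - (k ρ - 1) = m + 1 - k ρ := by have := hpos ρ hρ; omega
  have h2 : ∀ i, k i - 1 - (k ρ - 1) = k i - k ρ := by
    intro i; have := hpos ρ hρ; omega
  have h3 : (m + 1 - k ρ).choose (k j) ≤ (m + 1).choose (k j) :=
    Nat.choose_le_choose _ (Nat.sub_le _ _)
  obtain ⟨l, hl⟩ : ∃ l, k j = l + 1 := ⟨k j - 1, by have := hpos j hj; omega⟩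
  have h4 : (m + 1).choose (k j) = m.choose (k j - 1) + m.choose (k j) := by
    rw [hl]; exact Nat.choose_succ_succ m l
  rw [← add_sum_erase I _ hj, sum_sub_distrib]
  simp only [h1, h2]
  push_cast [Nat.cast_sub h3]
  rw [h4]
  push_cast
  ring

/-- If the family with the largest sets exceeds a star, then the total size is less than that of
stars or at most that of a hitting configuration, with the hitting configurations as only cases of
equality. -/
theorem sum_lt_or_le_hitting (hF : ∀ i ∈ I, F i ⊆ powersetCard (k i) univ)
    (hne : ∀ i ∈ I, (F i).Nonempty)
    (hpos : ∀ i ∈ I, 1 ≤ k i) (hpair : ∀ i ∈ I, ∀ j ∈ I, i ≠ j → k i + k j ≤ m + 1)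
    (hcross : ∀ i ∈ I, ∀ j ∈ I, i ≠ j → ∀ A ∈ F i, ∀ B ∈ F j, ¬ Disjoint A B)
    {j ρ : ℕ} (hj : j ∈ I) (hbig : m.choose (k j - 1) < #(F j)) (hρ : ρ ∈ I) (hρj : ρ ≠ j)
    (hmin : ∀ i ∈ I, k ρ ≤ k i) (hmax : ∀ i ∈ I, k i ≤ k j)
    (hm : ∀ i ∈ I, i ≠ j → k j + k i ≤ m) :
    ∑ i ∈ I, #(F i) < ∑ i ∈ I, m.choose (k i - 1) ∨
    (∑ i ∈ I, #(F i) ≤ (m + 1).choose (k j) - (m + 1 - k ρ).choose (k j) +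
        ∑ i ∈ I.erase j, (m + 1 - k ρ).choose (k i - k ρ) ∧
      (∑ i ∈ I, #(F i) = (m + 1).choose (k j) - (m + 1 - k ρ).choose (k j) +
        ∑ i ∈ I.erase j, (m + 1 - k ρ).choose (k i - k ρ) →
        ∃ S : Finset (Fin (m + 1)), #S = k ρ ∧
          F j = {X ∈ powersetCard (k j) (univ : Finset (Fin (m + 1))) | ¬ Disjoint X S} ∧
          ∀ i ∈ I.erase j, F i = {X ∈ powersetCard (k i) (univ : Finset (Fin (m + 1))) | S ⊆ X})) := by
  obtain ⟨G, hG, hGne, hGc, hadm, hle⟩ := exists_reduced_family hF hne hpos hpair hcross hj hbig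
  have hρI : ρ ∈ I.erase j := mem_erase.2 ⟨hρj, hρ⟩
  have hkρ : k ρ ≤ m := by have := hm ρ hρ hρj; omega
  rcases lt_or_ge (gain (I.erase j) (fun i => k i - 1) G) 0 with hneg | h0
  · left
    zify
    push_cast at hle
    linarith
  right
  -- A `(k ρ - 1)`-set outside the proper neighbourhood of `G` meets every member of `G`.
  have hAdm : Admissible (k j) (k ρ - 1) G := by
    refine ⟨hG, hGne, ?_⟩
    by_contra hcon
    push Not at hcon
    apply hadm ρ hρI
    refine Subset.antisymm (nbr_subset _ _) fun B hB => ?_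
    obtain ⟨A, hA, hd⟩ := hcon B (mem_powersetCard.1 hB).2
    exact mem_nbr.2 ⟨(mem_powersetCard.1 hB).2, A, hA, hd⟩
  have hgain := gain_le_hitting (b := fun i => k i - 1) hAdm h0 ?_ ?_ ?_ ⟨ρ, hρI, rfl⟩
  rotate_left
  · intro i hi
    rw [mem_erase] at hi
    have := hm i hi.2 hi.1
    have := hpos i hi.2
    rw [Fintype.card_fin]
    omega
  · intro i hi
    have hi := mem_of_mem_erase hi
    have := hmax i hi
    have := hpos i hi
    show k i - 1 < k j
    omega
  · intro i hi
    have := hmin i (mem_of_mem_erase hi)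
    show k ρ - 1 ≤ k i - 1
    omega
  rw [Fintype.card_fin] at hgain
  have htot := card_hitting_total hj hρ hpos (show k ρ ≤ m + 1 by omega)
  have hSle : ((∑ i ∈ I, #(F i) : ℕ) : ℤ) ≤
      (((m + 1).choose (k j) - (m + 1 - k ρ).choose (k j) +
        ∑ i ∈ I.erase j, (m + 1 - k ρ).choose (k i - k ρ) : ℕ) : ℤ) := by
    rw [← htot]
    linarith [hgain.1]
  refine ⟨by exact_mod_cast hSle, fun heq => ?_⟩
  have hGcard : #G = m.choose (k j) - (m - (k ρ - 1)).choose (k j) := by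
    refine hgain.2 (le_antisymm hgain.1 ?_)
    rw [heq, ← htot] at hle
    linarith
  -- Any member of `F ρ` serves as `S`: it is met by all of `F j`, which has the size of the full
  -- hitting family.
  obtain ⟨S, hS⟩ := hne ρ hρ
  have hSc := (mem_powersetCard.1 (hF ρ hρ hS)).2
  have hFj : F j = {X ∈ powersetCard (k j) (univ : Finset (Fin (m + 1))) | ¬ Disjoint X S} := by
    refine eq_of_subset_of_card_le (fun X hX => mem_filter.2 ⟨hF j hj hX,
      hcross j hj ρ hρ hρj.symm X hX S hS⟩) ?_
    rw [card_powersetCard_not_disjoint, Fintype.card_fin, hSc, hGc, hGcard]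
    have h1 : m - (k ρ - 1) = m + 1 - k ρ := by have := hpos ρ hρ; omega
    obtain ⟨l, hl⟩ : ∃ l, k j = l + 1 := ⟨k j - 1, by have := hpos j hj; omega⟩
    have h4 : (m + 1).choose (k j) = m.choose (k j - 1) + m.choose (k j) := by
      rw [hl]; exact Nat.choose_succ_succ m l
    rw [h1, h4]
    omega
  refine ⟨S, hSc, hFj, ?_⟩
  have hsub : ∀ i ∈ I.erase j, F i ⊆ {X ∈ powersetCard (k i) (univ : Finset (Fin (m + 1))) | S ⊆ X} := by
    intro i hi Y hY
    have hi' := mem_erase.1 hi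
    refine mem_filter.2 ⟨hF i hi'.2 hY, fun x hxS => ?_⟩
    by_contra hx
    have hYi := (mem_powersetCard.1 (hF i hi'.2 hY)).2
    have := hm i hi'.2 hi'.1
    obtain ⟨X, hxX, hXY, hXp⟩ := exists_subsuperset_card_eq (s := {x}) (t := Yᶜ) (n := k j)
      (by simpa using hx) (by simpa using hpos j hj)
      (by rw [card_compl, Fintype.card_fin]; omega)
    refine hcross j hj i hi'.2 hi'.1.symm X ?_ Y hY (subset_compl_iff_disjoint_right.1 hXY)
    rw [hFj]
    exact mem_filter.2 ⟨mem_powersetCard.2 ⟨subset_univ _, hXp⟩,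
      not_disjoint_iff.2 ⟨x, hxX (mem_singleton_self x), hxS⟩⟩
  have hcont : ∀ i ∈ I.erase j, #({X ∈ powersetCard (k i) (univ : Finset (Fin (m + 1))) | S ⊆ X}) = (m + 1 - k ρ).choose (k i - k ρ) := by
    intro i hi
    rw [card_powersetCard_superset (hSc ▸ hmin i (mem_of_mem_erase hi)), Fintype.card_fin, hSc]
  have hcj : #(F j) = (m + 1).choose (k j) - (m + 1 - k ρ).choose (k j) := by
    rw [hFj, card_powersetCard_not_disjoint, Fintype.card_fin, hSc]
  rw [← add_sum_erase I _ hj, hcj, add_right_inj, ← sum_congr rfl hcont,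
    sum_eq_sum_iff_of_le fun i hi => card_le_card (hsub i hi)] at heq
  exact fun i hi => eq_of_subset_of_card_le (hsub i hi) (heq i hi).ge

end Configuration

/-! ### Sets of half the size of the ground set. -/

section Half

variable {m k : ℕ} {I : Finset ℕ} {F : ℕ → Finset (Finset (Fin (m + 1)))}

/-- At least three pairwise cross-intersecting families of sets of half the size of the ground set
have total size at most that of stars, with equality only if they coincide. -/
theorem sum_le_of_half (hF : ∀ i ∈ I, F i ⊆ powersetCard k univ) (hI : 3 ≤ #I)
    (hcross : ∀ i ∈ I, ∀ j ∈ I, i ≠ j → ∀ A ∈ F i, ∀ B ∈ F j, ¬ Disjoint A B)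
    (hk : 1 ≤ k) (hm : m + 1 = k + k) :
    ∑ i ∈ I, #(F i) ≤ #I * m.choose (k - 1) ∧
    (∑ i ∈ I, #(F i) = #I * m.choose (k - 1) →
      ∀ i ∈ I, ∀ j ∈ I, F i = F j) := by
  set mult : Finset (Fin (m + 1)) → ℕ := fun A => #{i ∈ I | A ∈ F i} with hmult
  have h1 : ∑ i ∈ I, #(F i) = ∑ A ∈ powersetCard k univ, mult A := by
    have h := sum_card_bipartiteAbove_eq_sum_card_bipartiteBelow
      (s := I) (t := powersetCard k (univ : Finset (Fin (m + 1)))) (fun i A => A ∈ F i)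
    refine Eq.trans (sum_congr rfl fun i hi => ?_) h
    congr 1
    ext A
    rw [mem_bipartiteAbove]
    exact ⟨fun hA => ⟨hF i hi hA, hA⟩, fun hA => hA.2⟩
  have h2 : ∑ A ∈ powersetCard k univ, mult A = ∑ A ∈ powersetCard k univ, mult Aᶜ := by
    refine sum_nbij' compl compl ?_ ?_ ?_ ?_ ?_
    · intro A hA
      rw [mem_powersetCard] at hA ⊢
      exact ⟨subset_univ _, by rw [card_compl, Fintype.card_fin, hA.2]; omega⟩
    · intro A hA
      rw [mem_powersetCard] at hA ⊢
      exact ⟨subset_univ _, by rw [card_compl, Fintype.card_fin, hA.2]; omega⟩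
    · exact fun A _ => compl_compl A
    · exact fun A _ => compl_compl A
    · intro A _; rw [compl_compl]
  have hle : ∀ A, mult A ≤ #I := fun A => card_le_card (filter_subset _ _)
  have h3 : ∀ A, mult A + mult Aᶜ ≤ #I ∧
      (mult A + mult Aᶜ = #I → mult A = 0 ∨ mult A = #I) := by
    intro A
    rcases Nat.eq_zero_or_pos (mult A) with hA0 | hA0
    · have := hle Aᶜ
      exact ⟨by omega, fun _ => Or.inl hA0⟩
    rcases Nat.eq_zero_or_pos (mult Aᶜ) with hA1 | hA1
    · have := hle A
      exact ⟨by omega, fun _ => Or.inr (by omega)⟩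
    -- If both multiplicities are positive, both are 1, and their sum 2 is below #I.
    have hone : ∀ i ∈ I, ∀ j ∈ I, A ∈ F i → Aᶜ ∈ F j → i = j := by
      intro i hi j hj hAi hAj
      by_contra hij
      exact hcross i hi j hj hij A hAi _ hAj disjoint_compl_right
    obtain ⟨i, hi⟩ := card_pos.1 hA0
    obtain ⟨j, hj⟩ := card_pos.1 hA1
    rw [mem_filter] at hi hj
    have h4 : mult A ≤ 1 := card_le_one.2 fun u hu v hv => by
      rw [mem_filter] at hu hv
      rw [hone u hu.1 j hj.1 hu.2 hj.2, hone v hv.1 j hj.1 hv.2 hj.2]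
    have h5 : mult Aᶜ ≤ 1 := card_le_one.2 fun u hu v hv => by
      rw [mem_filter] at hu hv
      rw [← hone i hi.1 u hu.1 hi.2 hu.2, ← hone i hi.1 v hv.1 hi.2 hv.2]
    exact ⟨by omega, by omega⟩
  have h6 : #(powersetCard k (univ : Finset (Fin (m + 1)))) = 2 * m.choose (k - 1) := by
    obtain ⟨l, rfl⟩ : ∃ l, k = l + 1 := ⟨k - 1, by omega⟩
    rw [card_powersetCard, card_univ, Fintype.card_fin, Nat.choose_succ_succ,
      ← Nat.choose_symm_of_eq_add (show m = l + l.succ by omega), Nat.add_sub_cancel]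
    omega
  have h7 := sum_le_sum fun A (_ : A ∈ powersetCard k (univ : Finset (Fin (m + 1)))) => (h3 A).1
  have h8 : ∑ _A ∈ powersetCard k (univ : Finset (Fin (m + 1))), #I =
      2 * (#I * m.choose (k - 1)) := by
    rw [sum_const, h6, smul_eq_mul]; ring
  have h9 : ∑ A ∈ powersetCard k (univ : Finset (Fin (m + 1))), (mult A + mult Aᶜ) =
      2 * ∑ i ∈ I, #(F i) := by
    rw [sum_add_distrib, ← h2, ← h1]; ring
  refine ⟨by omega, fun heq => ?_⟩
  have h10 := (sum_eq_sum_iff_of_le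
    fun A (_ : A ∈ powersetCard k (univ : Finset (Fin (m + 1)))) => (h3 A).1).1
    (by rw [h8, h9, heq])
  have key : ∀ i ∈ I, ∀ j ∈ I, F i ⊆ F j := by
    intro i hi j hj A hA
    rcases (h3 A).2 (h10 A (hF i hi hA)) with h | h
    · rw [hmult, card_eq_zero, filter_eq_empty_iff] at h
      exact absurd hA (h hi)
    · have := eq_of_subset_of_card_le (filter_subset (fun i => A ∈ F i) I) h.ge
      rw [← this, mem_filter] at hj
      exact hj.2
  exact fun i hi j hj => Subset.antisymm (key i hi j hj) (key j hj i hi)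

end Half

/-! ### Assembling the cases. -/

section Main

theorem hittingFamily_eq (n k : ℕ) (S : Finset (Fin n)) :
    hittingFamily n k S = {X ∈ powersetCard k (univ : Finset (Fin n)) | ¬ Disjoint X S} := by
  ext X
  simp [hittingFamily, layer, not_disjoint_iff_nonempty_inter]

theorem sum_erase_eq_sum_Icc {r j : ℕ} {k : ℕ → ℕ} (hr : 1 ≤ r) (hj : j ∈ Icc 1 r)
    (hkj : k j = k 1) (f : ℕ → ℕ) :
    ∑ i ∈ (Icc 1 r).erase j, f (k i) = ∑ i ∈ Icc 2 r, f (k i) := by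
  have h1 : (1 : ℕ) ∈ Icc 1 r := mem_Icc.2 ⟨le_rfl, hr⟩
  have h2 : (Icc 1 r).erase 1 = Icc 2 r := by
    ext i; simp only [mem_erase, mem_Icc]; omega
  have h3 := add_sum_erase (Icc 1 r) (fun i => f (k i)) hj
  have h4 := add_sum_erase (Icc 1 r) (fun i => f (k i)) h1
  rw [h2] at h4
  simp only [hkj] at h3
  omega

theorem sum_card_eq_starBound {r m : ℕ} {k : ℕ → ℕ} (hpos : ∀ i ∈ Icc 1 r, 1 ≤ k i)
    {F : ℕ → Finset (Finset (Fin (m + 1)))} {x : Fin (m + 1)}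
    (h : ∀ i ∈ Icc 1 r, F i = starFamily (m + 1) (k i) x) :
    ∑ i ∈ Icc 1 r, #(F i) = starBound (m + 1) r k := by
  refine sum_congr rfl fun i hi => ?_
  rw [h i hi]
  exact card_star (hpos i hi) x

theorem sum_card_eq_hittingBound {r m j : ℕ} {k : ℕ → ℕ} (hj : j ∈ Icc 1 r) (hkj : k j = k 1)
    (hmin : ∀ i ∈ Icc 1 r, k r ≤ k i)
    {F : ℕ → Finset (Finset (Fin (m + 1)))} {S : Finset (Fin (m + 1))}
    (hS : S ∈ layer (m + 1) (k r)) (hFj : F j = hittingFamily (m + 1) (k j) S)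
    (hFi : ∀ i ∈ Icc 1 r, i ≠ j → F i = containingFamily (m + 1) (k i) S) :
    ∑ i ∈ Icc 1 r, #(F i) = hittingBound (m + 1) r k := by
  have hSc := (mem_powersetCard.1 hS).2
  have hr : 1 ≤ r := (mem_Icc.1 hj).1.trans (mem_Icc.1 hj).2
  rw [← add_sum_erase _ _ hj, hittingBound,
    ← sum_erase_eq_sum_Icc hr hj hkj (fun t => (m + 1 - k r).choose (t - k r)), hFj,
    hittingFamily_eq, card_powersetCard_not_disjoint, Fintype.card_fin, hSc, hkj]
  congr 1
  refine sum_congr rfl fun i hi => ?_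
  rw [mem_erase] at hi
  rw [hFi i hi.2 hi.1, containingFamily, layer,
    card_powersetCard_superset (hSc ▸ hmin i hi.2), Fintype.card_fin, hSc]

variable {r m : ℕ} {k : ℕ → ℕ} {F : ℕ → Finset (Finset (Fin (m + 1)))}

/-- The bound and the necessity of its cases of equality, if two of the families have sets of total
size less than the ground set. -/
theorem sum_le_max_of_pair (hr : 2 ≤ r) (hpos : ∀ i ∈ Icc 1 r, 1 ≤ k i)
    (hmono : ∀ i ∈ Icc 1 r, ∀ j ∈ Icc 1 r, i ≤ j → k j ≤ k i) (hn : k 1 + k 2 ≤ m + 1)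
    (hF : ∀ i ∈ Icc 1 r, F i ⊆ powersetCard (k i) univ) (hne : ∀ i ∈ Icc 1 r, (F i).Nonempty)
    (hpair : ∀ i ∈ Icc 1 r, ∀ j ∈ Icc 1 r, i ≠ j → k i + k j ≤ k 1 + k 2)
    (hcross : ∀ i ∈ Icc 1 r, ∀ j ∈ Icc 1 r, i ≠ j → ∀ A ∈ F i, ∀ B ∈ F j, ¬ Disjoint A B)
    {p q : ℕ} (hp : p ∈ Icc 1 r) (hq : q ∈ Icc 1 r) (hpq : p ≠ q) (hpqm : k p + k q ≤ m) :
    ∑ i ∈ Icc 1 r, #(F i) ≤ max (hittingBound (m + 1) r k) (starBound (m + 1) r k) ∧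
    (∑ i ∈ Icc 1 r, #(F i) = max (hittingBound (m + 1) r k) (starBound (m + 1) r k) →
      (hittingBound (m + 1) r k ≤ starBound (m + 1) r k ∧
        ∃ x, ∀ i ∈ Icc 1 r, F i = starFamily (m + 1) (k i) x) ∨
      (k 1 + k r < m + 1 ∧ starBound (m + 1) r k ≤ hittingBound (m + 1) r k ∧
        ∃ S ∈ layer (m + 1) (k r), ∃ j ∈ Icc 1 r, k j = k 1 ∧
          F j = hittingFamily (m + 1) (k j) S ∧
          ∀ i ∈ Icc 1 r, i ≠ j → F i = containingFamily (m + 1) (k i) S)) := by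
  have hpair' : ∀ i ∈ Icc 1 r, ∀ j ∈ Icc 1 r, i ≠ j → k i + k j ≤ m + 1 :=
    fun i hi j hj hij => (hpair i hi j hj hij).trans hn
  have m1 : (1 : ℕ) ∈ Icc 1 r := mem_Icc.2 ⟨le_rfl, by omega⟩
  have m2 : (2 : ℕ) ∈ Icc 1 r := mem_Icc.2 ⟨by omega, hr⟩
  have mr : r ∈ Icc 1 r := mem_Icc.2 ⟨by omega, le_rfl⟩
  have hs : starBound (m + 1) r k = ∑ i ∈ Icc 1 r, m.choose (k i - 1) := rfl
  by_cases hall : ∀ i ∈ Icc 1 r, #(F i) ≤ m.choose (k i - 1)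
  · have hle := sum_le_sum hall
    rw [← hs] at hle
    refine ⟨hle.trans (le_max_right _ _), fun heq => Or.inl ?_⟩
    have h1 := le_max_left (hittingBound (m + 1) r k) (starBound (m + 1) r k)
    have h2 := le_max_right (hittingBound (m + 1) r k) (starBound (m + 1) r k)
    refine ⟨by omega, ?_⟩
    exact eq_stars_of_card_le hF hpos hpair' hcross hall (by rw [← hs]; omega) hp hq hpq hpqm
  push Not at hall
  obtain ⟨j, hj, hbig⟩ := hall
  have hj1 := hmono 1 m1 j hj (mem_Icc.1 hj).1
  have hlt : ∑ i ∈ Icc 1 r, #(F i) < starBound (m + 1) r k →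
      ∑ i ∈ Icc 1 r, #(F i) < max (hittingBound (m + 1) r k) (starBound (m + 1) r k) :=
    fun h => h.trans_le (le_max_right _ _)
  have hthree : ∀ i ∈ Icc 1 r, 3 ≤ r → ∃ l ∈ Icc 1 r, l ≠ i ∧ l ≠ j := by
    intro i hi h3
    have : 0 < #(((Icc 1 r).erase i).erase j) := by
      have h1 := pred_card_le_card_erase (s := (Icc 1 r).erase i) (a := j)
      rw [card_erase_of_mem hi, Nat.card_Icc] at h1
      omega
    obtain ⟨l, hl⟩ := card_pos.1 this
    rw [mem_erase, mem_erase] at hl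
    exact ⟨l, hl.2.2, hl.2.1, hl.1⟩
  have htwo : r = 2 → k 1 + k 2 ≤ m := by
    rintro rfl
    rw [mem_Icc] at hp hq
    obtain ⟨rfl, rfl⟩ | ⟨rfl, rfl⟩ : (p = 1 ∧ q = 2) ∨ (p = 2 ∧ q = 1) := by omega
    · exact hpqm
    · omega
  -- If the large family is not of maximum set size, layer `k 1 - 1` is at least as high as `k j`,
  -- and the total stays below s.
  rcases hj1.lt_or_eq with hj1 | hj1
  · have h1j : 1 ≠ j := by rintro rfl; omega
    have h := hlt (sum_lt_of_big_of_large_layer hF hne hpos hpair' hcross hj hbig m1 h1j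
      (Or.inl (by omega)) (by
        rcases eq_or_ne r 2 with rfl | hr2
        · right
          have := htwo rfl
          have : j = 2 := by rw [mem_Icc] at hj; omega
          subst this
          have := hpos 1 m1
          omega
        · exact Or.inl (hthree 1 m1 (by omega))))
    exact ⟨h.le, fun heq => absurd heq h.ne⟩
  rcases hn.lt_or_eq with hn1 | hn1
  -- If `j = r`, then `k r = k 1` and index 1 can carry the minimum size.
  · obtain ⟨ρ, hρ, hρj, hkρ⟩ : ∃ ρ ∈ Icc 1 r, ρ ≠ j ∧ k ρ = k r := by
      rcases eq_or_ne j r with rfl | hjr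
      · exact ⟨1, m1, by omega, hj1.symm⟩
      · exact ⟨r, mr, hjr.symm, rfl⟩
    have hmin : ∀ i ∈ Icc 1 r, k r ≤ k i := fun i hi => hmono i hi r mr (mem_Icc.1 hi).2
    have hmax : ∀ i ∈ Icc 1 r, k i ≤ k j := fun i hi => by
      rw [hj1]; exact hmono 1 m1 i hi (mem_Icc.1 hi).1
    have hcase := sum_lt_or_le_hitting hF hne hpos hpair' hcross hj hbig hρ hρj
      (by rw [hkρ]; exact hmin) hmax (fun i hi hij => by
        have := hpair j hj i hi hij.symm; omega)
    have hh : (m + 1).choose (k j) - (m + 1 - k ρ).choose (k j) +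
        ∑ i ∈ (Icc 1 r).erase j, (m + 1 - k ρ).choose (k i - k ρ) =
        hittingBound (m + 1) r k := by
      rw [hkρ, hj1, hittingBound,
        sum_erase_eq_sum_Icc (by omega) hj hj1 (fun t => (m + 1 - k r).choose (t - k r))]
    rw [hh] at hcase
    rcases hcase with h | ⟨hle, heq⟩
    · have h := hlt h
      exact ⟨h.le, fun heq => absurd heq h.ne⟩
    refine ⟨hle.trans (le_max_left _ _), fun he => Or.inr ?_⟩
    have h1 := le_max_left (hittingBound (m + 1) r k) (starBound (m + 1) r k)
    have h2 := le_max_right (hittingBound (m + 1) r k) (starBound (m + 1) r k)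
    obtain ⟨S, hSc, hFj, hFi⟩ := heq (by omega)
    refine ⟨?_, by omega, S, mem_powersetCard.2 ⟨subset_univ _, hSc.trans hkρ⟩, j, hj, hj1, ?_, ?_⟩
    · have := hmono 2 m2 r mr hr
      omega
    · rw [hFj, hittingFamily_eq]
    · exact fun i hi hij => hFi i (mem_erase.2 ⟨hij, hi⟩)
  -- Here n = k_1 + k_2, so `hpqm` excludes r = 2, and the layers k_1 and k_2 - 1 are complementary
  -- on m points.
  · have hr3 : 3 ≤ r := by
      rcases eq_or_ne r 2 with h | h
      · have := htwo h; omega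
      · omega
    obtain ⟨i, hi, hij, hki⟩ : ∃ i ∈ Icc 1 r, i ≠ j ∧ k i = k 2 := by
      rcases eq_or_ne j 1 with rfl | hj1'
      · exact ⟨2, m2, by omega, rfl⟩
      · refine ⟨1, m1, hj1'.symm, le_antisymm ?_ (hmono 1 m1 2 m2 (by omega))⟩
        rw [← hj1]
        have := mem_Icc.1 hj
        exact hmono 2 m2 j hj (by omega)
    have hk2 := hpos 2 m2
    have h := hlt (sum_lt_of_big_of_large_layer hF hne hpos hpair' hcross hj hbig hi hij
      (Or.inr (by omega)) (Or.inl (hthree i hi hr3)))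
    exact ⟨h.le, fun heq => absurd heq h.ne⟩

theorem choose_eq_choose_of_add {m k₁ l : ℕ} (hl : 1 ≤ l) (hm : m + 1 = k₁ + l) (hk : 1 ≤ k₁) :
    (m + 1).choose k₁ = m.choose (k₁ - 1) + m.choose (l - 1) := by
  obtain ⟨t, rfl⟩ : ∃ t, k₁ = t + 1 := ⟨k₁ - 1, by omega⟩
  rw [Nat.choose_succ_succ, Nat.add_sub_cancel]
  congr 1
  exact Nat.choose_symm_of_eq_add (by omega)

/-- Here every containing family is a single set, and s - h = (r - 2)(C(m, k_r - 1) - 1). -/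
theorem hittingBound_le_starBound (hr : 2 ≤ r) (hm : m + 1 = k 1 + k r)
    (hconst : ∀ i ∈ Icc 2 r, k i = k r) (h1 : 1 ≤ k 1) (h2 : 1 ≤ k r) :
    hittingBound (m + 1) r k ≤ starBound (m + 1) r k := by
  have hI : Icc 1 r = insert 1 (Icc 2 r) := by
    ext i; simp only [mem_insert, mem_Icc]; omega
  have e1 : ∑ i ∈ Icc 2 r, (m + 1 - k r).choose (k i - k r) = r - 1 := by
    rw [sum_congr rfl (g := fun _ => 1) (fun i hi => by rw [hconst i hi]; simp)]
    simp
  have e2 : ∑ i ∈ Icc 2 r, m.choose (k i - 1) = (r - 1) * m.choose (k r - 1) := by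
    rw [sum_congr rfl (g := fun _ => m.choose (k r - 1)) (fun i hi => by rw [hconst i hi])]
    simp
  have e3 : m + 1 - k r = k 1 := by omega
  rw [hittingBound, starBound, hI, sum_insert (by simp), Nat.add_sub_cancel, e1, e2, e3,
    Nat.choose_self, choose_eq_choose_of_add h2 hm h1]
  have hc : 1 ≤ m.choose (k r - 1) := Nat.choose_pos (by omega)
  obtain ⟨t, rfl⟩ : ∃ t, r = t + 2 := ⟨r - 2, by omega⟩
  obtain ⟨c, hc'⟩ : ∃ c, m.choose (k (t + 2) - 1) = c + 1 :=
    ⟨_, (Nat.sub_add_cancel hc).symm⟩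
  rw [hc', show t + 2 - 1 = t + 1 by omega]
  nlinarith [Nat.zero_le (t * c), Nat.sub_le (m.choose (k 1 - 1) + (c + 1)) 1,
    Nat.sub_add_cancel (show 1 ≤ m.choose (k 1 - 1) + (c + 1) by omega)]

/-- With k₁ + k₂ = n, cross-intersection says just that `A` contains no complement of a member of
`B`. -/
theorem card_add_card_eq_iff {k₁ k₂ : ℕ} {A B : Finset (Finset (Fin (m + 1)))}
    (hm : m + 1 = k₁ + k₂) (hA : A ⊆ powersetCard k₁ univ) (hB : B ⊆ powersetCard k₂ univ)
    (hcross : ∀ X ∈ A, ∀ Y ∈ B, ¬ Disjoint X Y) :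
    #A + #B ≤ (m + 1).choose k₁ ∧
    (#A + #B = (m + 1).choose k₁ ↔ A = layer (m + 1) k₁ \ complementFamily B) := by
  have hcard : #(complementFamily B) = #B := by
    refine card_image_of_injective _ fun X Y h => ?_
    simpa [← compl_eq_univ_sdiff] using h
  have hsub : complementFamily B ⊆ layer (m + 1) k₁ := by
    intro X hX
    obtain ⟨Y, hY, rfl⟩ := mem_image.1 hX
    have := (mem_powersetCard.1 (hB hY)).2
    refine mem_powersetCard.2 ⟨subset_univ _, ?_⟩
    rw [← compl_eq_univ_sdiff, card_compl, Fintype.card_fin, this]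
    omega
  have hle : A ⊆ layer (m + 1) k₁ \ complementFamily B := by
    intro X hX
    refine mem_sdiff.2 ⟨hA hX, fun h => ?_⟩
    obtain ⟨Y, hY, rfl⟩ := mem_image.1 h
    exact hcross _ hX Y hY sdiff_disjoint
  have hc : #(layer (m + 1) k₁ \ complementFamily B) + #B = (m + 1).choose k₁ := by
    rw [← hcard, card_sdiff_add_card_eq_card hsub, layer, card_powersetCard, card_univ,
      Fintype.card_fin]
  have h1 := card_le_card hle
  refine ⟨by omega, fun h => eq_of_subset_of_card_le hle (by omega), fun h => ?_⟩
  rw [← hc, ← h]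

end Main

theorem theorem1p7 (r n : ℕ) (hr : 2 ≤ r) (k : ℕ → ℕ)
    (hpos : ∀ i ∈ Icc 1 r, 1 ≤ k i)
    (hmono : ∀ i ∈ Icc 1 r, ∀ j ∈ Icc 1 r, i ≤ j → k j ≤ k i)
    (hn : k 1 + k 2 ≤ n)
    (F : ℕ → Finset (Finset (Fin n)))
    (hF : ∀ i ∈ Icc 1 r, F i ⊆ layer n (k i))
    (hne : ∀ i ∈ Icc 1 r, (F i).Nonempty)
    (hcross : CrossIntersecting r F) :
    ∑ i ∈ Icc 1 r, #(F i) ≤ max (hittingBound n r k) (starBound n r k) ∧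
    (∑ i ∈ Icc 1 r, #(F i) = max (hittingBound n r k) (starBound n r k) ↔
      (n = k 1 + k r ∧
        ((r = 2 ∧ F 1 = layer n (k 1) \ complementFamily (F 2) ∧
            0 < #(F 2) ∧ #(F 2) < n.choose (k 2)) ∨
         (2 < r ∧ k 2 < k 1 ∧ (∀ i ∈ Icc 2 r, k i = k r) ∧
            ∃ x : Fin n, ∀ i ∈ Icc 1 r, F i = starFamily n (k i) x) ∨
         (2 < r ∧ (∀ i ∈ Icc 1 r, k i = k 1) ∧
            ∃ G : Finset (Finset (Fin n)), G ⊆ layer n (k 1) ∧ IntersectingFamily G ∧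
              #G = (n - 1).choose (k 1 - 1) ∧ ∀ i ∈ Icc 1 r, F i = G))) ∨
      (k 1 + k r < n ∧
        ((hittingBound n r k ≤ starBound n r k ∧
            ∃ x : Fin n, ∀ i ∈ Icc 1 r, F i = starFamily n (k i) x) ∨
         (starBound n r k ≤ hittingBound n r k ∧
            ∃ S ∈ layer n (k r), ∃ j ∈ Icc 1 r, k j = k 1 ∧
              F j = hittingFamily n (k j) S ∧
              ∀ i ∈ Icc 1 r, i ≠ j → F i = containingFamily n (k i) S)))) := by
  have m1 : (1 : ℕ) ∈ Icc 1 r := mem_Icc.2 ⟨le_rfl, by omega⟩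
  have m2 : (2 : ℕ) ∈ Icc 1 r := mem_Icc.2 ⟨by omega, hr⟩
  have mr : r ∈ Icc 1 r := mem_Icc.2 ⟨by omega, le_rfl⟩
  have p1 := hpos 1 m1
  have p2 := hpos 2 m2
  have pr := hpos r mr
  obtain ⟨m, rfl⟩ : ∃ m, n = m + 1 := ⟨n - 1, by omega⟩
  have h21 := hmono 1 m1 2 m2 (by omega)
  have hr2 := hmono 2 m2 r mr hr
  have hmin : ∀ i ∈ Icc 1 r, k r ≤ k i := fun i hi => hmono i hi r mr (mem_Icc.1 hi).2
  have hcross' : ∀ i ∈ Icc 1 r, ∀ j ∈ Icc 1 r, i ≠ j → ∀ A ∈ F i, ∀ B ∈ F j,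
      ¬ Disjoint A B := by
    have key : ∀ i ∈ Icc 1 r, ∀ j ∈ Icc 1 r, i < j → ∀ A ∈ F i, ∀ B ∈ F j, ¬ Disjoint A B := by
      intro i hi j hj hij A hA B hB
      rw [not_disjoint_iff_nonempty_inter]
      exact card_pos.1 (hcross i hi j hj hij A hA B hB)
    intro i hi j hj hij A hA B hB
    rcases lt_or_gt_of_ne hij with h | h
    · exact key i hi j hj h A hA B hB
    · exact fun hd => key j hj i hi h B hB A hA hd.symm
  have hpair : ∀ i ∈ Icc 1 r, ∀ j ∈ Icc 1 r, i ≠ j → k i + k j ≤ k 1 + k 2 := by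
    have key : ∀ i ∈ Icc 1 r, ∀ j ∈ Icc 1 r, i < j → k i + k j ≤ k 1 + k 2 := by
      intro i hi j hj hij
      have h1 := (mem_Icc.1 hi).1
      exact Nat.add_le_add (hmono 1 m1 i hi h1) (hmono 2 m2 j hj (by omega))
    intro i hi j hj hij
    rcases lt_or_gt_of_ne hij with h | h
    · exact key i hi j hj h
    · rw [add_comm]; exact key j hj i hi h
  have hs_of_le : hittingBound (m + 1) r k ≤ starBound (m + 1) r k →
      max (hittingBound (m + 1) r k) (starBound (m + 1) r k) = starBound (m + 1) r k :=
    max_eq_right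
  rcases (show k 1 + k r ≤ m + 1 by omega).lt_or_eq with hlt | heq
  · have hM := sum_le_max_of_pair hr hpos hmono hn hF hne hpair hcross' m1 mr (by omega)
      (by omega)
    refine ⟨hM.1, fun h => Or.inr ⟨hlt, ?_⟩, ?_⟩
    · rcases hM.2 h with h | ⟨-, h⟩
      · exact Or.inl h
      · exact Or.inr h
    · rintro (⟨h, -⟩ | ⟨-, ⟨hle, x, hx⟩ | ⟨hle, S, hS, j, hj, hkj, hFj, hFi⟩⟩)
      · omega
      · rw [hs_of_le hle, sum_card_eq_starBound hpos hx]
      · rw [max_eq_left hle, sum_card_eq_hittingBound hj hkj hmin hS hFj hFi]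
  have hconst : ∀ i ∈ Icc 2 r, k i = k r := by
    intro i hi
    rw [mem_Icc] at hi
    have hi' : i ∈ Icc 1 r := mem_Icc.2 ⟨by omega, hi.2⟩
    have := hmin i hi'
    have := hmono 2 m2 i hi' hi.1
    omega
  have hle := hittingBound_le_starBound hr heq.symm hconst p1 pr
  rw [hs_of_le hle]
  rcases hr.lt_or_eq with hr3 | rfl
  swap
  · have h12 : Icc 1 2 = ({1, 2} : Finset ℕ) := rfl
    have hsum : ∑ i ∈ Icc 1 2, #(F i) = #(F 1) + #(F 2) := by
      rw [h12, sum_pair (by omega)]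
    have hsb : starBound (m + 1) 2 k = (m + 1).choose (k 1) := by
      rw [starBound, h12, sum_pair (by omega), choose_eq_choose_of_add p2 heq.symm p1]
      rfl
    have h := card_add_card_eq_iff heq.symm (hF 1 m1) (hF 2 m2) (hcross' 1 m1 2 m2 (by omega))
    rw [hsum, hsb]
    refine ⟨h.1, fun he => Or.inl ⟨heq.symm, Or.inl ⟨rfl, h.2.1 he, card_pos.2 (hne 2 m2), ?_⟩⟩, ?_⟩
    · rw [← Nat.choose_symm_of_eq_add heq.symm, ← he]
      have := card_pos.2 (hne 1 m1)
      omega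
    · rintro (⟨-, ⟨-, h1, -⟩ | ⟨h1, -⟩ | ⟨h1, -⟩⟩ | ⟨h1, -⟩)
      · exact h.2.2 h1
      all_goals omega
  have m3 : 3 ∈ Icc 1 r := mem_Icc.2 ⟨by omega, hr3⟩
  have h32 := hmono 2 m2 3 m3 (by omega)
  rcases h21.lt_or_eq with h21 | h21
  -- Indices 1 and r now have sizes summing to n, but k_2 + k_3 < k_1 + k_2 = n. The hitting
  -- alternative is void, since it requires k_1 + k_r < n.
  · have hM := sum_le_max_of_pair hr hpos hmono hn hF hne hpair hcross' m2 m3 (by omega)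
      (by omega)
    rw [hs_of_le hle] at hM
    refine ⟨hM.1, fun h => Or.inl ⟨heq.symm, Or.inr (Or.inl ⟨hr3, h21, hconst, ?_⟩)⟩, ?_⟩
    · rcases hM.2 h with h | ⟨h, -⟩
      · exact h.2
      · omega
    · rintro (⟨-, ⟨h1, -⟩ | ⟨-, -, -, x, hx⟩ | ⟨-, h1, -⟩⟩ | ⟨h1, -⟩)
      · omega
      · exact sum_card_eq_starBound hpos hx
      · have := h1 2 m2; omega
      · omega
  · have hk1 : ∀ i ∈ Icc 1 r, k i = k 1 := by
      intro i hi
      have := hmin i hi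
      have := hmono 1 m1 i hi (mem_Icc.1 hi).1
      omega
    have hsb : starBound (m + 1) r k = #(Icc 1 r) * m.choose (k 1 - 1) := by
      rw [starBound, sum_congr rfl (g := fun _ => m.choose (k 1 - 1))
        (fun i hi => by rw [hk1 i hi]; rfl), sum_const, smul_eq_mul]
    have hM := sum_le_of_half (I := Icc 1 r) (k := k 1) (fun i hi => hk1 i hi ▸ hF i hi)
      (by rw [Nat.card_Icc]; omega) hcross' p1 (by omega)
    rw [hsb]
    refine ⟨hM.1, fun h => Or.inl ⟨heq.symm, Or.inr (Or.inr ⟨hr3, hk1, F 1, hF 1 m1, ?_, ?_, ?_⟩)⟩,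
      ?_⟩
    · intro A hA B hB
      rw [hM.2 h 1 m1 2 m2] at hB
      exact hcross 1 m1 2 m2 (by omega) A hA B hB
    · rw [sum_congr rfl (g := fun _ => #(F 1)) (fun i hi => by rw [hM.2 h i hi 1 m1]), sum_const,
        smul_eq_mul] at h
      exact Nat.eq_of_mul_eq_mul_left (card_pos.2 ⟨1, m1⟩) h
    · exact fun i hi => hM.2 h i hi 1 m1
    · rintro (⟨-, ⟨h1, -⟩ | ⟨-, h1, -⟩ | ⟨-, -, G, -, -, hGc, hG⟩⟩ | ⟨h1, -⟩)
      · omega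
      · omega
      · rw [sum_congr rfl (g := fun _ => #G) (fun i hi => by rw [hG i hi]), sum_const,
          smul_eq_mul, hGc]
        rfl
      · omega
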